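/- Let $p$ be a prime and let $1\le m\le n\le p$ be integers with $m+n\ge p+1$. For a commutative ring $R$ put $T_R=R[s]/(s^m)\otimes_R R[t]/(t^n)$, graded by total degree in $s,t$. For $h\in T_R$, $h\neq 0$, let $\mathrm{gr}(h)$ be its nonzero homogeneous component of lowest degree and $\deg_*(h)$ the degree of that component. Let $M_d=\mathbb{Q}[t]/(t^d)$ with the action of $\mathbb{Z}$ in which the generator $\sigma=1$ acts as multiplication by $1+t$, with lattice $M_d(\mathbb{Z})=\mathbb{Z}[t]/(t^d)$; for $d\le p$ let $V_d=\mathbb{F}_p[t]/(t^d)$ with the action of $C_p=\langle\sigma\rangle$ in which $\sigma$ acts as multiplication by $1+t$. Thus $M_m\otimes M_n=T_{\mathbb{Q}}$, $M_m(\mathbb{Z})\otimes M_n(\mathbb{Z})=T_{\mathbb{Z}}$ and $V_m\otimes V_n=T_{\mathbb{F}_p}$. Let $\Delta=\sigma-1$ and let $\rho:T_{\mathbb{Z}}\to T_{\mathbb{F}_p}$ be reduction modulo $p$. The length $\ell(\omega)$ of a nonzero $\omega\in W$ with $\Delta\omega=0$ is the largest $l\geq 1$ with $\omega\in\Delta^{l-1}(W)$.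 There exist $\omega_0,\dots,\omega_{m-1}\in T_{\mathbb{Z}}$ with $\Delta(\omega_r)=0$, $\deg_*(\omega_r)=m+n-r-2$ and $\mathrm{gr}(\omega_r)=\pm\sum_{i=0}^r(-1)^i s^{m-1-i}t^{n-1-r+i}$ for all $r$. For every such family the following hold. (1) $\ell(\rho(\omega_r))=m+n-2r-1$ in $V_m\otimes V_n$ for $m+n-p\le r\le m-1$. (2) There exist $\alpha_0,\dots,\alpha_{m-1}\in T_{\mathbb{Z}}$ such that for every $0\le r\le m-1$: $\deg_*(\alpha_r)=r$; $\Delta^{m+n-2r-2}(\alpha_r)=a_r\omega_r$ for some nonzero integer $a_r$; $\rho(\alpha_r)\ne0$; and, if $r\ge m+n-p$, $\deg_*(\rho(\alpha_r))=r$. (3) Let $(\alpha_r)$ be any family as in (2). Then $M_m\otimes M_n=\bigoplus_{r=0}^{m-1}N_r$, where $N_r=\mathrm{Span}_{\mathbb{Q}}\{\Delta^j(\alpha_r)\mid 0\le j\le m+n-2r-2\}$ is an indecomposable subrepresentation isomorphic to $M_{m+n-2r-1}$. Moreover $$V_m\otimes V_n=\bigoplus_{r=m+n-p}^{m-1}U_r\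 \oplus\ \bigoplus_{k=1}^{m+n-p}P_k,$$ where $U_r=\mathrm{Span}_{\mathbb{F}_p}\{\Delta^j(\rho(\alpha_r))\mid 0\le j\le m+n-2r-2\}$ is an indecomposable subrepresentation isomorphic to $V_{m+n-2r-1}$, and the $P_k$ are subrepresentations isomorphic to $V_p$. Finally $\rho\bigl(N_r\cap T_{\mathbb{Z}}\bigr)=U_r$ for $m+n-p\le r\le m-1$. -/

import Mathlib

open scoped Polynomial TensorProduct

noncomputable section

namespace CyclicTensor

/-- The truncated polynomial ring `R[t]/(t^n)`. -/
abbrev TruncPoly (R : Type) [CommRing R] (n : ℕ) : Type :=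
  AdjoinRoot (Polynomial.X ^ n : R[X])

/-- The class of the variable `t` in `R[t]/(t^n)`. -/
def tvar (R : Type) [CommRing R] (n : ℕ) : TruncPoly R n :=
  AdjoinRoot.root (Polynomial.X ^ n : R[X])

theorem tvar_pow (R : Type) [CommRing R] (n : ℕ) : tvar R n ^ n = 0 := by
  have h := AdjoinRoot.eval₂_root (Polynomial.X ^ n : R[X])
  simpa [tvar] using h

theorem isUnit_one_add_tvar (R : Type) [CommRing R] (n : ℕ) : IsUnit (1 + tvar R n) :=
  IsNilpotent.isUnit_one_add ⟨n, tvar_pow R n⟩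

/-- `1 + t` as a unit of `R[t]/(t^n)`. In the basis `1, t, …, t^(n-1)`, multiplication by it is
the `n × n` Jordan block with eigenvalue `1`. -/
def sigmaUnit (R : Type) [CommRing R] (n : ℕ) : (TruncPoly R n)ˣ :=
  (isUnit_one_add_tvar R n).unit

/-- The representation of the group `ℤ` on `R[t]/(t^n)` in which `1 ∈ ℤ` acts as multiplication by
`1 + t`. For `R = ℚ` this is `M_n`; for `R = ℤ` it is the lattice `M_n(ℤ)`. -/
def repM (R : Type) [CommRing R] (n : ℕ) :
    Representation R (Multiplicative ℤ) (TruncPoly R n) :=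
  (Algebra.lmul R (TruncPoly R n)).toMonoidHom.comp
    ((Units.coeHom (TruncPoly R n)).comp (zpowersHom (TruncPoly R n)ˣ (sigmaUnit R n)))

theorem one_add_tvar_pow (p n : ℕ) [Fact p.Prime] (hn : n ≤ p) :
    (1 + tvar (ZMod p) n) ^ p = 1 := by
  have h0 : tvar (ZMod p) n ^ p = 0 := pow_eq_zero_of_le hn (tvar_pow _ _)
  have hp : (p : TruncPoly (ZMod p) n) = 0 := by
    rw [← map_natCast (algebraMap (ZMod p) (TruncPoly (ZMod p) n)) p, ZMod.natCast_self, map_zero]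
  obtain ⟨r, hr⟩ := exists_add_pow_prime_eq (Fact.out : p.Prime) (1 : TruncPoly (ZMod p) n)
    (tvar (ZMod p) n)
  rw [hr, h0, hp]
  simp

/-- `V_n`, for `n ≤ p`: the representation of the cyclic group `C_p` (the additive group of
`ZMod p`, written multiplicatively) on `𝔽_p[t]/(t^n)` in which the generator `σ = 1` acts as
multiplication by `1 + t`. -/
def repV (p : ℕ) [Fact p.Prime] (n : ℕ) (hn : n ≤ p) :
    Representation (ZMod p) (Multiplicative (ZMod p)) (TruncPoly (ZMod p) n) where
  toFun g := Algebra.lmul (ZMod p) (TruncPoly (ZMod p) n)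
    ((1 + tvar (ZMod p) n) ^ (Multiplicative.toAdd g).val)
  map_one' := by
    rw [toAdd_one, ZMod.val_zero, pow_zero, map_one]
  map_mul' g h := by
    rw [← map_mul, ← pow_add, toAdd_mul, ZMod.val_add,
      ← pow_eq_pow_mod _ (one_add_tvar_pow p n hn)]

/-- `Δ = σ - 1` for a chosen group element `σ`. -/
def delta {R G V : Type} [CommRing R] [Monoid G] [AddCommGroup V] [Module R V]
    (ρ : Representation R G V) (σ : G) : Module.End R V :=
  ρ σ - 1

/-- `ℓ(ω) = l`: `l ≥ 1` is maximal with `ω ∈ Δ^(l-1)(W)`. -/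
def HasLength {R V : Type} [CommRing R] [AddCommGroup V] [Module R V]
    (D : Module.End R V) (ω : V) (l : ℕ) : Prop :=
  IsGreatest {k : ℕ | 1 ≤ k ∧ ω ∈ LinearMap.range (D ^ (k - 1))} l

/-- `R[s]/(s^m) ⊗ R[t]/(t^n)`. -/
abbrev TT (R : Type) [CommRing R] (m n : ℕ) : Type :=
  TruncPoly R m ⊗[R] TruncPoly R n

/-- The `ℤ`-representation `M_m ⊗ M_n` (for `R = ℚ`), or its lattice `M_m(ℤ) ⊗ M_n(ℤ)`
(for `R = ℤ`). -/
def repMM (R : Type) [CommRing R] (m n : ℕ) : Representation R (Multiplicative ℤ) (TT R m n) :=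
  (repM R m).tprod (repM R n)

/-- `Δ` on `M_m ⊗ M_n`, respectively on `M_m(ℤ) ⊗ M_n(ℤ)`. -/
def deltaM (R : Type) [CommRing R] (m n : ℕ) : Module.End R (TT R m n) :=
  delta (repMM R m n) (Multiplicative.ofAdd 1)

/-- The `C_p`-representation `V_m ⊗ V_n`. -/
def repVV (p : ℕ) [Fact p.Prime] (m n : ℕ) (hm : m ≤ p) (hn : n ≤ p) :
    Representation (ZMod p) (Multiplicative (ZMod p)) (TT (ZMod p) m n) :=
  (repV p m hm).tprod (repV p n hn)

/-- `Δ` on `V_m ⊗ V_n`. -/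
def deltaV (p : ℕ) [Fact p.Prime] (m n : ℕ) (hm : m ≤ p) (hn : n ≤ p) :
    Module.End (ZMod p) (TT (ZMod p) m n) :=
  delta (repVV p m n hm hn) (Multiplicative.ofAdd 1)

/-- The monomial `s^i t^j` in `R[s]/(s^m) ⊗ R[t]/(t^n)` (it is `0` if `i ≥ m` or `j ≥ n`). -/
def mono (R : Type) [CommRing R] (m n i j : ℕ) : TT R m n :=
  (tvar R m ^ i) ⊗ₜ[R] (tvar R n ^ j)

/-- The homogeneous elements of total degree `d`. -/
def homog (R : Type) [CommRing R] (m n d : ℕ) : Submodule R (TT R m n) :=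
  Submodule.span R {x | ∃ i j : ℕ, i + j = d ∧ x = mono R m n i j}

/-- The filtration step `F_d`: combinations of monomials of total degree at least `d`. -/
def filt (R : Type) [CommRing R] (m n d : ℕ) : Submodule R (TT R m n) :=
  Submodule.span R {x | ∃ i j : ℕ, d ≤ i + j ∧ x = mono R m n i j}

/-- `deg_*(h) = d`: the lowest nonzero homogeneous component of `h` has degree `d`. -/
def HasLowDegree {R : Type} [CommRing R] {m n : ℕ} (h : TT R m n) (d : ℕ) : Prop :=
  h ∈ filt R m n d ∧ h ∉ filt R m n (d + 1)

/-- `gr(h) = g` with `deg_*(h) = d`: the lowest nonzero homogeneous component of `h` is `g`, of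
degree `d`. -/
def HasInitialForm {R : Type} [CommRing R] {m n : ℕ} (h g : TT R m n) (d : ℕ) : Prop :=
  g ∈ homog R m n d ∧ g ≠ 0 ∧ h - g ∈ filt R m n (d + 1)

/-- The ring homomorphism `ℤ[t]/(t^n) → S[t]/(t^n)` with `t ↦ t`. -/
def castOne (S : Type) [CommRing S] (n : ℕ) : TruncPoly ℤ n →+* TruncPoly S n :=
  AdjoinRoot.lift (Int.castRingHom (TruncPoly S n)) (tvar S n) (by simp [tvar_pow])

/-- The ring homomorphism `ℤ[s]/(s^m) ⊗ ℤ[t]/(t^n) → S[s]/(s^m) ⊗ S[t]/(t^n)` with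
`a ⊗ b ↦ castOne a ⊗ castOne b`. For `S = ℚ` it is the inclusion of the lattice
`M_m(ℤ) ⊗ M_n(ℤ)` into `M_m ⊗ M_n`; for `S = ZMod p` it is the reduction modulo `p` onto
`V_m ⊗ V_n`. -/
def castTT (S : Type) [CommRing S] (m n : ℕ) : TT ℤ m n →+* TT S m n :=
  (Algebra.TensorProduct.lift
    ((Algebra.TensorProduct.includeLeftRingHom.comp (castOne S m)).toIntAlgHom)
    (((Algebra.TensorProduct.includeRight :
        TruncPoly S n →ₐ[S] TT S m n).toRingHom.comp (castOne S n)).toIntAlgHom)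
    (fun _ _ => Commute.all _ _)).toRingHom

theorem castTT_tmul (S : Type) [CommRing S] (m n : ℕ) (a : TruncPoly ℤ m) (b : TruncPoly ℤ n) :
    castTT S m n (a ⊗ₜ[ℤ] b) = castOne S m a ⊗ₜ[S] castOne S n b := by
  simp [castTT]

/-- Reduction modulo `p`. -/
abbrev red (p m n : ℕ) : TT ℤ m n →+* TT (ZMod p) m n := castTT (ZMod p) m n

/-- The inclusion of the lattice. -/
abbrev incl (m n : ℕ) : TT ℤ m n →+* TT ℚ m n := castTT ℚ m n

/-- `ω_0, …, ω_{m-1} ∈ M_m(ℤ) ⊗ M_n(ℤ)` satisfy `Δ(ω_r) = 0`, `deg_*(ω_r) = m + n - r - 2` and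
`gr(ω_r) = ± ∑_{i=0}^r (-1)^i s^(m-1-i) t^(n-1-r+i)`. -/
def IsSocleFamily (m n : ℕ) (ω : ℕ → TT ℤ m n) : Prop :=
  ∀ r < m, deltaM ℤ m n (ω r) = 0 ∧
    ∃ ε : ℤ, (ε = 1 ∨ ε = -1) ∧
      HasInitialForm (ω r)
        (ε • ∑ i ∈ Finset.range (r + 1), (-1 : ℤ) ^ i • mono ℤ m n (m - 1 - i) (n - 1 - r + i))
        (m + n - r - 2)

/-- Integral generators `α_0, …, α_{m-1} ∈ M_m(ℤ) ⊗ M_n(ℤ)` over the socle elements `ω_r`, with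
denominators cleared so that no `α_r` vanishes modulo `p`, and that for `r ≥ m + n - p` the lowest
homogeneous component of `α_r` does not vanish modulo `p`. -/
def IsGeneratorFamily (p m n : ℕ) (ω α : ℕ → TT ℤ m n) : Prop :=
  ∀ r < m, HasLowDegree (α r) r ∧
    (∃ a : ℤ, a ≠ 0 ∧ (deltaM ℤ m n ^ (m + n - 2 * r - 2)) (α r) = a • ω r) ∧
    red p m n (α r) ≠ 0 ∧
    (m + n - p ≤ r → HasLowDegree (red p m n (α r)) r)

/-- A nonzero representation that is not a direct sum of two nonzero subrepresentations. -/
def IsIndecomposable {k G V : Type} [Field k] [Group G] [AddCommGroup V] [Module k V]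
    (ρ : Representation k G V) : Prop :=
  Nontrivial V ∧ ∀ A B : Subrepresentation ρ,
    IsCompl A.toSubmodule B.toSubmodule → A.toSubmodule = ⊥ ∨ B.toSubmodule = ⊥

/-- `ρ ≅ M_d` as a representation of `ℤ`. -/
def IsIsoM {V : Type} [AddCommGroup V] [Module ℚ V]
    (ρ : Representation ℚ (Multiplicative ℤ) V) (d : ℕ) : Prop :=
  Nonempty (ρ.Equiv (repM ℚ d))

/-- `d ≤ p` and `ρ ≅ V_d` as a representation of `C_p`. -/
def IsIsoV (p : ℕ) [Fact p.Prime] {V : Type} [AddCommGroup V] [Module (ZMod p) V]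
    (ρ : Representation (ZMod p) (Multiplicative (ZMod p)) V) (d : ℕ) : Prop :=
  ∃ h : d ≤ p, Nonempty (ρ.Equiv (repV p d h))

/-- `Span{D^j(v) | 0 ≤ j < l}`. -/
def cyclicSpan {R V : Type} [CommRing R] [AddCommGroup V] [Module R V]
    (D : Module.End R V) (v : V) (l : ℕ) : Submodule R V :=
  Submodule.span R {x | ∃ j < l, x = (D ^ j) v}

end CyclicTensor

end

open CyclicTensor

/-! Since σ acts as (1+s)(1+t), the operator Δ is multiplication by x = s + t + st (`deltaM_eq`,
`deltaV_eq`), whose initial form is s + t. Everything is read off the filtration by total degree.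

The core is a hard Lefschetz property: with N = m+n-2r-2, multiplication by (s+t)^N from degree r to
degree r+N is bijective over a field in which (m+n-r-2)! is nonzero. Injectivity is a statement
about polynomials in one variable (`eq_zero_of_coeff_one_add_X_pow_mul`), and surjectivity follows
by dimension. The property applies over ℚ for all r, and over 𝔽_p for r ≥ m+n-p. Successive
approximation turns it into solvability of x^N y = h in the filtered algebra
(`exists_xel_pow_mul_eq`), and Nakayama's lemma carries that to ℤ up to an integer factor prime to a
chosen prime. This gives the α_r.

For the decompositions, Jordan chains with independent last vectors are independent, and they fill
the space once their lengths add up to mn (`isInternal_jordan`). The last vectors a_r ω_r have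
distinct lowest degrees, hence are independent (`linearIndependent_of_lowDegree`). Modulo p,
Lefschetz injectivity keeps a_r nonzero for r ≥ m+n-p; the other chains are replaced by those of
length p generated by s^k, k < m+n-p. The lengths of the ρ(ω_r) follow from this decomposition. The
equality ρ(N_r ∩ T_ℤ) = U_r holds because the independent chain modulo p allows every factor p to be
removed from a common denominator. -/

noncomputable section

namespace CyclicTensor

/-! ### Jordan chains of a linear operator -/

section Jordan

variable {K V : Type} [Field K] [AddCommGroup V] [Module K V]

theorem pow_apply_eq_zero_of_le {D : Module.End K V} {v : V} {l k : ℕ} (h : (D ^ l) v = 0)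
    (hk : l ≤ k) : (D ^ k) v = 0 := by
  obtain ⟨c, rfl⟩ := Nat.exists_eq_add_of_le' hk
  rw [pow_add, Module.End.mul_apply, h, map_zero]

/-- Jordan chains whose last vectors are linearly independent are linearly independent. -/
theorem linearIndependent_jordan {ι : Type} [Fintype ι] (D : Module.End K V) (v : ι → V)
    (l : ι → ℕ) (h0 : ∀ i, (D ^ l i) (v i) = 0)
    (hli : LinearIndependent K fun i => (D ^ (l i - 1)) (v i)) :
    LinearIndependent K fun x : Σ i, Fin (l i) => (D ^ (x.2 : ℕ)) (v x.1) := by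
  classical
  rw [Fintype.linearIndependent_iff]
  intro a ha
  by_contra! hne
  obtain ⟨x₀, hx₀⟩ := hne
  -- Take a nonzero coefficient whose vector has maximal height k, the number of steps to the end of
  -- its chain. Then D^(k-1) kills all lower vectors and sends those of height k to last vectors.
  obtain ⟨x, hx, hmax⟩ := Finset.exists_max_image (Finset.univ.filter fun x => a x ≠ 0)
    (fun x => l x.1 - (x.2 : ℕ)) ⟨x₀, by simpa using hx₀⟩
  have hx1 : a x ≠ 0 := by simpa using hx
  obtain ⟨k, hk⟩ : ∃ k, k = l x.1 - (x.2 : ℕ) := ⟨_, rfl⟩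
  have hxl := x.2.2
  set b : ι → K := fun i => if h : k ≤ l i ∧ 0 < k then a ⟨i, ⟨l i - k, by omega⟩⟩ else 0 with hb
  have key : ∑ i, b i • (D ^ (l i - 1)) (v i) = 0 := by
    have h1 := congrArg (D ^ (k - 1)) ha
    rw [map_zero, map_sum, Fintype.sum_sigma] at h1
    rw [← h1]
    refine Finset.sum_congr rfl fun i _ => ?_
    by_cases h : k ≤ l i ∧ 0 < k
    · rw [Finset.sum_eq_single (⟨l i - k, by omega⟩ : Fin (l i))]
      · simp only [hb, dif_pos h, map_smul, ← Module.End.mul_apply, ← pow_add]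
        congr 4
        omega
      · intro j _ hj
        have hj' : (j : ℕ) ≠ l i - k := fun h2 => hj (Fin.ext h2)
        have := j.2
        rcases lt_or_gt_of_ne hj' with h2 | h2
        · have : a ⟨i, j⟩ = 0 := by
            by_contra h3
            have := hmax ⟨i, j⟩ (by simpa using h3)
            change l i - (j : ℕ) ≤ l x.1 - (x.2 : ℕ) at this
            omega
          rw [this, zero_smul, map_zero]
        · rw [map_smul, ← Module.End.mul_apply, ← pow_add,
            pow_apply_eq_zero_of_le (h0 i) (show l i ≤ k - 1 + (j : ℕ) by omega), smul_zero]
      · simp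
    · simp only [hb, dif_neg h, zero_smul]
      symm
      refine Finset.sum_eq_zero fun j _ => ?_
      have := j.2
      rw [map_smul, ← Module.End.mul_apply, ← pow_add,
        pow_apply_eq_zero_of_le (h0 i) (by omega), smul_zero]
  have h2 := (Fintype.linearIndependent_iff.mp hli) b key x.1
  have h3 : k ≤ l x.1 ∧ 0 < k := by omega
  simp only [hb, dif_pos h3] at h2
  apply hx1
  rw [← h2]
  congr 1
  refine Sigma.ext rfl (heq_of_eq (Fin.ext ?_))
  simp only
  omega

theorem linearIndependent_chain (D : Module.End K V) (v : V) (l : ℕ)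
    (h0 : (D ^ l) v = 0) (h1 : (D ^ (l - 1)) v ≠ 0) :
    LinearIndependent K fun j : Fin l => (D ^ (j : ℕ)) v := by
  have := linearIndependent_jordan D (fun _ : Unit => v) (fun _ => l) (fun _ => h0)
    (LinearIndependent.of_subsingleton () h1)
  exact this.comp (fun j : Fin l => (⟨(), j⟩ : Σ _ : Unit, Fin l)) (fun i j h => by simpa using h)

theorem cyclicSpan_eq (D : Module.End K V) (v : V) (l : ℕ) :
    cyclicSpan D v l = Submodule.span K (Set.range fun j : Fin l => (D ^ (j : ℕ)) v) := by
  unfold cyclicSpan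
  congr 1
  ext x
  constructor
  · rintro ⟨j, hj, rfl⟩
    exact ⟨⟨j, hj⟩, rfl⟩
  · rintro ⟨j, rfl⟩
    exact ⟨j, j.2, rfl⟩

theorem pow_mem_cyclicSpan {D : Module.End K V} {v : V} {l : ℕ} (h0 : (D ^ l) v = 0) (j : ℕ) :
    (D ^ j) v ∈ cyclicSpan D v l := by
  by_cases hj : j < l
  · exact Submodule.subset_span ⟨j, hj, rfl⟩
  · rw [pow_apply_eq_zero_of_le h0 (not_lt.mp hj)]
    exact Submodule.zero_mem _

theorem apply_mem_cyclicSpan {D : Module.End K V} {v : V} {l : ℕ} (h0 : (D ^ l) v = 0) {x : V}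
    (hx : x ∈ cyclicSpan D v l) : D x ∈ cyclicSpan D v l := by
  have : cyclicSpan D v l ≤ (cyclicSpan D v l).comap D := by
    refine Submodule.span_le.mpr ?_
    rintro _ ⟨j, -, rfl⟩
    have := pow_mem_cyclicSpan h0 (j + 1)
    rwa [pow_succ', Module.End.mul_apply] at this
  exact this hx

theorem jordan_span [FiniteDimensional K V] {ι : Type} [Fintype ι] (D : Module.End K V) (v : ι → V)
    (l : ι → ℕ) (h0 : ∀ i, (D ^ l i) (v i) = 0)
    (hli : LinearIndependent K fun i => (D ^ (l i - 1)) (v i))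
    (hdim : ∑ i, l i = Module.finrank K V) :
    ⊤ ≤ Submodule.span K (Set.range fun x : Σ i, Fin (l i) => (D ^ (x.2 : ℕ)) (v x.1)) :=
  ((linearIndependent_jordan D v l h0 hli).span_eq_top_of_card_eq_finrank' (by simp [hdim])).ge

/-- Jordan chains of the right total length with linearly independent last vectors
decompose the space. -/
theorem isInternal_jordan [FiniteDimensional K V] {ι : Type} [Fintype ι] [DecidableEq ι]
    (D : Module.End K V) (v : ι → V)
    (l : ι → ℕ) (h0 : ∀ i, (D ^ l i) (v i) = 0)
    (hli : LinearIndependent K fun i => (D ^ (l i - 1)) (v i))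
    (hdim : ∑ i, l i = Module.finrank K V) :
    DirectSum.IsInternal fun i => cyclicSpan D (v i) (l i) := by
  have hsurj : Function.Surjective (DirectSum.coeLinearMap fun i => cyclicSpan D (v i) (l i)) := by
    rw [← LinearMap.range_eq_top, DirectSum.range_coeLinearMap, eq_top_iff]
    refine (jordan_span D v l h0 hli hdim).trans (Submodule.span_le.mpr ?_)
    rintro _ ⟨x, rfl⟩
    exact Submodule.mem_iSup_of_mem x.1 (pow_mem_cyclicSpan (h0 x.1) _)
  have hfin : ∀ i, Module.finrank K (cyclicSpan D (v i) (l i)) = l i := by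
    intro i
    have h := (linearIndependent_jordan D v l h0 hli).comp
      (fun j : Fin (l i) => (⟨i, j⟩ : Σ i, Fin (l i))) (fun a b h => by simpa using h)
    rw [cyclicSpan_eq]
    exact (finrank_span_eq_card h).trans (Fintype.card_fin _)
  have hinj := (LinearMap.injective_iff_surjective_of_finrank_eq_finrank (by
    rw [Module.finrank_directSum, ← hdim]
    exact Finset.sum_congr rfl fun i _ => hfin i)).mpr hsurj
  exact ⟨hinj, hsurj⟩

/-- The last vector of a chain of length `l i` in a Jordan decomposition is not in the image
of `D ^ l i`. -/
theorem jordan_notMem_range [FiniteDimensional K V] {ι : Type} [Fintype ι]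
    (D : Module.End K V) (v : ι → V)
    (l : ι → ℕ) (h0 : ∀ i, (D ^ l i) (v i) = 0)
    (hli : LinearIndependent K fun i => (D ^ (l i - 1)) (v i))
    (hdim : ∑ i, l i = Module.finrank K V) (i : ι) (hl : 1 ≤ l i) :
    (D ^ (l i - 1)) (v i) ∉ LinearMap.range (D ^ l i) := by
  classical
  let b := Module.Basis.mk (linearIndependent_jordan D v l h0 hli) (jordan_span D v l h0 hli hdim)
  have hb : ∀ x, b x = (D ^ (x.2 : ℕ)) (v x.1) := fun x => by simp [b]
  let x₀ : Σ i, Fin (l i) := ⟨i, ⟨l i - 1, by omega⟩⟩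
  -- D^(l i) shifts each basis vector along its own chain by l i places or kills it, so it never
  -- reaches position l i - 1 of chain i.
  have hzero : b.coord x₀ ∘ₗ (D ^ l i) = 0 := by
    refine b.ext fun x => ?_
    rw [LinearMap.comp_apply, hb, ← Module.End.mul_apply, ← pow_add]
    by_cases h : l i + x.2 < l x.1
    · have := hb ⟨x.1, ⟨l i + x.2, h⟩⟩
      simp only at this
      rw [← this, Module.Basis.coord_apply, Module.Basis.repr_self, LinearMap.zero_apply,
        Finsupp.single_eq_of_ne]
      rintro heq
      obtain ⟨j, hj⟩ := x
      simp only [x₀, Sigma.mk.injEq] at heq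
      obtain ⟨rfl, heq⟩ := heq
      have := congrArg Fin.val (eq_of_heq heq)
      simp only at this
      omega
    · rw [pow_apply_eq_zero_of_le (h0 x.1) (not_lt.mp h), map_zero, LinearMap.zero_apply]
  rintro ⟨y, hy⟩
  have h1 := LinearMap.congr_fun hzero y
  rw [LinearMap.comp_apply, hy, ← hb x₀, Module.Basis.coord_apply, Module.Basis.repr_self] at h1
  simp at h1

end Jordan

/-- The basis `1, t, …, t^(n-1)` of `R[t]/(t^n)`. -/
def truncBasis (R : Type) [CommRing R] [Nontrivial R] (n : ℕ) :
    Module.Basis (Fin n) R (TruncPoly R n) :=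
  (AdjoinRoot.powerBasis' (Polynomial.monic_X_pow (R := R) n)).basis.reindex
    (finCongr (by simp))

theorem truncBasis_apply (R : Type) [CommRing R] [Nontrivial R] (n : ℕ) (i : Fin n) :
    truncBasis R n i = tvar R n ^ (i : ℕ) := by
  rw [truncBasis, Module.Basis.reindex_apply, PowerBasis.basis_eq_pow]
  rfl

/-! ### Representations of a cyclic group on Jordan chains -/

section Rep

variable {K G V : Type} [Field K] [Group G] [AddCommGroup V] [Module K V]

/-- D shifts the chain, so only the coefficient of the last vector is unconstrained: the kernel of D
on a chain is a line. -/
theorem mem_span_last_of_apply_eq_zero {D : Module.End K V} {v : V} {k : ℕ}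
    (h0 : (D ^ (k + 1)) v = 0) (h1 : (D ^ k) v ≠ 0) {y : V} (hy : y ∈ cyclicSpan D v (k + 1))
    (hDy : D y = 0) : ∃ c : K, y = c • (D ^ k) v := by
  rw [cyclicSpan_eq, Submodule.mem_span_range_iff_exists_fun] at hy
  obtain ⟨c, rfl⟩ := hy
  have hli := (linearIndependent_chain D v (k + 1) h0 h1).comp Fin.succ (Fin.succ_injective k)
  rw [map_sum, Fin.sum_univ_castSucc] at hDy
  simp only [map_smul, ← Module.End.mul_apply, ← pow_succ', Fin.val_last, h0, smul_zero,
    add_zero, Fin.val_castSucc] at hDy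
  have hc := Fintype.linearIndependent_iff.mp hli (fun i => c i.castSucc) hDy
  refine ⟨c (Fin.last k), ?_⟩
  rw [Fin.sum_univ_castSucc]
  simp [hc]

theorem delta_apply (ρ : Representation K G V) (g : G) (x : V) : delta ρ g x = ρ g x - x := rfl

theorem apply_mem_of_generator [FiniteDimensional K V] (ρ : Representation K G V) {g₀ : G}
    (hg : ∀ g, g ∈ Subgroup.zpowers g₀) {W : Submodule K V}
    (hW : ∀ x ∈ W, ρ g₀ x ∈ W) (g : G) {x : V} (hx : x ∈ W) : ρ g x ∈ W := by
  have hinj : Function.Injective (ρ g₀) := by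
    intro a b hab
    have := congrArg (ρ g₀⁻¹) hab
    simpa using this
  -- By finite dimension an injective map of W into itself is onto, so the inverse of the generator
  -- also preserves W.
  have hmap : W.map (ρ g₀) = W := by
    refine Submodule.eq_of_le_of_finrank_eq (Submodule.map_le_iff_le_comap.mpr hW) ?_
    exact (LinearEquiv.finrank_eq (Submodule.equivMapOfInjective _ hinj W)).symm
  have hinv : ∀ x ∈ W, ρ g₀⁻¹ x ∈ W := by
    intro x hx
    rw [← hmap] at hx
    obtain ⟨y, hy, rfl⟩ := hx
    simpa using hy
  have hpow : ∀ (h : G), (∀ x ∈ W, ρ h x ∈ W) → ∀ (k : ℕ), ∀ x ∈ W, ρ (h ^ k) x ∈ W := by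
    intro h hh k
    induction k with
    | zero => simp
    | succ k ih =>
      intro x hx
      rw [pow_succ, map_mul, Module.End.mul_apply]
      exact ih _ (hh x hx)
  obtain ⟨k, rfl⟩ := Subgroup.mem_zpowers_iff.mp (hg g)
  obtain ⟨k, rfl | rfl⟩ := k.eq_nat_or_neg
  · simpa using hpow g₀ hW k x hx
  · simpa using hpow g₀⁻¹ hinv k x hx

theorem intertwines_of_generator {V' : Type} [AddCommGroup V'] [Module K V']
    (ρ : Representation K G V) (ρ' : Representation K G V') {g₀ : G}
    (hg : ∀ g, g ∈ Subgroup.zpowers g₀) (e : V ≃ₗ[K] V')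
    (he : ∀ x, e (ρ g₀ x) = ρ' g₀ (e x)) (g : G) : ∀ x, e (ρ g x) = ρ' g (e x) := by
  have hinv : ∀ x, e (ρ g₀⁻¹ x) = ρ' g₀⁻¹ (e x) := by
    intro x
    have := congrArg (ρ' g₀⁻¹) (he (ρ g₀⁻¹ x))
    simpa using this.symm
  have hpow : ∀ h : G, (∀ x, e (ρ h x) = ρ' h (e x)) → ∀ (k : ℕ) x,
      e (ρ (h ^ k) x) = ρ' (h ^ k) (e x) := by
    intro h hh k
    induction k with
    | zero => simp
    | succ k ih =>
      intro x
      rw [pow_succ, map_mul, Module.End.mul_apply, ih, hh, map_mul, Module.End.mul_apply]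
  obtain ⟨k, rfl⟩ := Subgroup.mem_zpowers_iff.mp (hg g)
  obtain ⟨k, rfl | rfl⟩ := k.eq_nat_or_neg
  · simpa using hpow g₀ he k
  · simpa using hpow g₀⁻¹ hinv k

/-- The subrepresentation spanned by a Jordan chain. -/
def cyclicSubrep [FiniteDimensional K V] (ρ : Representation K G V) {g₀ : G}
    (hg : ∀ g, g ∈ Subgroup.zpowers g₀) (v : V) (l : ℕ) (h0 : (delta ρ g₀ ^ l) v = 0) :
    Subrepresentation ρ where
  toSubmodule := cyclicSpan (delta ρ g₀) v l
  apply_mem_toSubmodule g _ hx := apply_mem_of_generator ρ hg (fun x hx => by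
    have := Submodule.add_mem _ (apply_mem_cyclicSpan h0 hx) hx
    rwa [delta_apply, sub_add_cancel] at this) g hx

/-- The last vector of the chain lies in every nonzero subrepresentation, so no two of these are
disjoint. -/
theorem cyclicSubrep_isIndecomposable [FiniteDimensional K V] (ρ : Representation K G V) {g₀ : G}
    (hg : ∀ g, g ∈ Subgroup.zpowers g₀) (v : V) (l : ℕ) (h0 : (delta ρ g₀ ^ l) v = 0)
    (h1 : (delta ρ g₀ ^ (l - 1)) v ≠ 0) :
    IsIndecomposable (cyclicSubrep ρ hg v l h0).toRepresentation := by
  obtain ⟨k, rfl⟩ : ∃ k, l = k + 1 := by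
    cases l with
    | zero => exact absurd h0 h1
    | succ k => exact ⟨k, rfl⟩
  rw [Nat.add_sub_cancel] at h1
  set W := cyclicSubrep ρ hg v (k + 1) h0
  let w : W.toSubmodule := ⟨_, pow_mem_cyclicSpan h0 k⟩
  have hw : w ≠ 0 := fun h => h1 (congrArg Subtype.val h)
  have key : ∀ A : Subrepresentation W.toRepresentation, A.toSubmodule ≠ ⊥ →
      w ∈ A.toSubmodule := by
    intro A hA
    obtain ⟨a, ha, ha0⟩ := Submodule.exists_mem_ne_zero_of_ne_bot hA
    have hpow : ∀ j : ℕ, ∃ b ∈ A.toSubmodule, (b : V) = (delta ρ g₀ ^ j) a := by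
      intro j
      induction j with
      | zero => exact ⟨a, ha, rfl⟩
      | succ j ih =>
        obtain ⟨b, hb, hba⟩ := ih
        refine ⟨W.toRepresentation g₀ b - b, A.toSubmodule.sub_mem
          (A.apply_mem_toSubmodule g₀ hb) hb, ?_⟩
        rw [pow_succ', Module.End.mul_apply, ← hba]
        rfl
    have hnil : (delta ρ g₀ ^ (k + 1)) (a : V) = 0 := by
      have : cyclicSpan (delta ρ g₀) v (k + 1) ≤ LinearMap.ker (delta ρ g₀ ^ (k + 1)) := by
        refine Submodule.span_le.mpr ?_
        rintro _ ⟨j, -, rfl⟩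
        rw [SetLike.mem_coe, LinearMap.mem_ker, ← Module.End.mul_apply, ← pow_add]
        exact pow_apply_eq_zero_of_le h0 (by omega)
      exact this a.2
    -- The last nonzero iterate of a under Δ is killed by Δ, hence is a nonzero multiple of the last
    -- vector of the chain.
    classical
    have hex : ∃ j, (delta ρ g₀ ^ j) (a : V) = 0 := ⟨_, hnil⟩
    obtain ⟨j, hj⟩ : ∃ j, Nat.find hex = j + 1 := by
      refine Nat.exists_eq_succ_of_ne_zero fun h => ha0 ?_
      have := Nat.find_spec hex
      rw [h] at this
      exact Subtype.ext this
    have hj1 := Nat.find_spec hex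
    have hj0 := Nat.find_min hex (m := j) (by omega)
    rw [hj] at hj1
    obtain ⟨b, hb, hba⟩ := hpow j
    obtain ⟨c, hc⟩ := mem_span_last_of_apply_eq_zero h0 h1 b.2 (by
      rw [hba, ← Module.End.mul_apply, ← pow_succ', hj1])
    have hc0 : c ≠ 0 := by
      rintro rfl
      rw [zero_smul] at hc
      exact hj0 (hba ▸ hc)
    have : w = c⁻¹ • b := by
      refine Subtype.ext ?_
      rw [Submodule.coe_smul, hc, inv_smul_smul₀ hc0]
    rw [this]
    exact A.toSubmodule.smul_mem _ hb
  refine ⟨⟨w, 0, hw⟩, fun A B hAB => ?_⟩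
  by_contra! h
  exact hw (Submodule.disjoint_def.mp hAB.disjoint w (key A h.1) (key B h.2))

/-- The isomorphism sends Δ^j v to t^j; it is enough to check that it commutes with the generator.
-/
theorem cyclicSubrep_equiv [FiniteDimensional K V] (ρ : Representation K G V) {g₀ : G}
    (hg : ∀ g, g ∈ Subgroup.zpowers g₀) (v : V) (l : ℕ) (h0 : (delta ρ g₀ ^ l) v = 0)
    (h1 : (delta ρ g₀ ^ (l - 1)) v ≠ 0) (ρ' : Representation K G (TruncPoly K l))
    (hρ' : ∀ f, ρ' g₀ f = (1 + tvar K l) * f) :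
    Nonempty ((cyclicSubrep ρ hg v l h0).toRepresentation.Equiv ρ') := by
  have hli := linearIndependent_chain (delta ρ g₀) v l h0 h1
  let b : Module.Basis (Fin l) K (cyclicSubrep ρ hg v l h0).toSubmodule :=
    (Module.Basis.span hli).map (LinearEquiv.ofEq _ _ (cyclicSpan_eq (delta ρ g₀) v l).symm)
  have hb : ∀ i, (b i : V) = (delta ρ g₀ ^ (i : ℕ)) v := by
    intro i
    simp only [b, Module.Basis.map_apply]
    exact congrArg Subtype.val (Module.Basis.span_apply hli i)
  let e := b.equiv (truncBasis K l) (Equiv.refl _)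
  have he : ∀ x, e ((cyclicSubrep ρ hg v l h0).toRepresentation g₀ x) = ρ' g₀ (e x) := by
    intro x
    have : e.toLinearMap ∘ₗ (cyclicSubrep ρ hg v l h0).toRepresentation g₀ =
        ρ' g₀ ∘ₗ e.toLinearMap := by
      refine b.ext fun i => ?_
      have hei : ∀ i, e (b i) = tvar K l ^ (i : ℕ) := fun i => by
        rw [Module.Basis.equiv_apply, Equiv.refl_apply, truncBasis_apply]
      simp only [LinearMap.comp_apply, LinearEquiv.coe_coe]
      rw [hei, hρ', add_mul, one_mul, ← pow_succ']
      by_cases hi : (i : ℕ) + 1 < l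
      · have : (cyclicSubrep ρ hg v l h0).toRepresentation g₀ (b i) = b i + b ⟨i + 1, hi⟩ := by
          refine Subtype.ext ?_
          rw [Submodule.coe_add, hb ⟨i + 1, hi⟩, pow_succ', Module.End.mul_apply, ← hb i,
            delta_apply]
          simp [Subrepresentation.toRepresentation]
        rw [this, map_add, hei, hei]
      · have : (cyclicSubrep ρ hg v l h0).toRepresentation g₀ (b i) = b i := by
          refine Subtype.ext ?_
          have h2 : delta ρ g₀ (b i) = 0 := by
            rw [hb, ← Module.End.mul_apply, ← pow_succ']
            exact pow_apply_eq_zero_of_le h0 (by omega)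
          rw [delta_apply, sub_eq_zero] at h2
          exact h2
        rw [this, hei, pow_eq_zero_of_le (by omega : l ≤ (i : ℕ) + 1) (tvar_pow K l), add_zero]
    exact LinearMap.congr_fun this x
  exact ⟨Representation.Equiv.mk e fun g => LinearMap.ext
    (intertwines_of_generator _ ρ' hg e he g)⟩

end Rep

/-! ### Monomial coordinates, the degree filtration and homogeneous forms -/

section Coordinates

variable {R : Type} [CommRing R] {m n : ℕ}

theorem mono_mul_mono (a b c d : ℕ) :
    mono R m n a b * mono R m n c d = mono R m n (a + c) (b + d) := by
  simp [mono, Algebra.TensorProduct.tmul_mul_tmul, pow_add]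

theorem mono_zero_zero : mono R m n 0 0 = 1 := by
  simp [mono, Algebra.TensorProduct.one_def]

theorem mono_eq_zero_left {i : ℕ} (j : ℕ) (h : m ≤ i) : mono R m n i j = 0 := by
  rw [mono, pow_eq_zero_of_le h (tvar_pow R m), TensorProduct.zero_tmul]

theorem mono_eq_zero_right (i : ℕ) {j : ℕ} (h : n ≤ j) : mono R m n i j = 0 := by
  rw [mono, pow_eq_zero_of_le h (tvar_pow R n), TensorProduct.tmul_zero]

theorem mono_pow (a b k : ℕ) : mono R m n a b ^ k = mono R m n (k * a) (k * b) := by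
  induction k with
  | zero => simp [mono_zero_zero]
  | succ k ih => rw [pow_succ, ih, mono_mul_mono]; congr 1 <;> ring

/-- The basis of monomials. -/
def monoBasis (R : Type) [CommRing R] [Nontrivial R] (m n : ℕ) :
    Module.Basis (Fin m × Fin n) R (TT R m n) :=
  (truncBasis R m).tensorProduct (truncBasis R n)

theorem monoBasis_apply [Nontrivial R] (x : Fin m × Fin n) :
    monoBasis R m n x = mono R m n x.1 x.2 := by
  obtain ⟨i, j⟩ := x
  rw [monoBasis, Module.Basis.tensorProduct_apply, truncBasis_apply, truncBasis_apply, mono]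

theorem repr_mono [Nontrivial R] (i j : ℕ) (x : Fin m × Fin n) :
    (monoBasis R m n).repr (mono R m n i j) x = if (x.1 : ℕ) = i ∧ (x.2 : ℕ) = j then 1 else 0 := by
  by_cases hi : i < m
  · by_cases hj : j < n
    · have := monoBasis_apply (R := R) ((⟨i, hi⟩, ⟨j, hj⟩) : Fin m × Fin n)
      simp only at this
      rw [← this, Module.Basis.repr_self, Finsupp.single_apply]
      congr 1
      simp only [Prod.ext_iff, Fin.ext_iff, eq_comm]
    · rw [mono_eq_zero_right i (not_lt.mp hj), map_zero, Finsupp.zero_apply, if_neg]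
      have := x.2.2
      omega
  · rw [mono_eq_zero_left j (not_lt.mp hi), map_zero, Finsupp.zero_apply, if_neg]
    have := x.1.2
    omega

theorem mono_mem_filt {i j d : ℕ} (h : d ≤ i + j) : mono R m n i j ∈ filt R m n d :=
  Submodule.subset_span ⟨i, j, h, rfl⟩

theorem mem_filt_iff [Nontrivial R] {h : TT R m n} {d : ℕ} :
    h ∈ filt R m n d ↔
      ∀ x : Fin m × Fin n, (x.1 : ℕ) + x.2 < d → (monoBasis R m n).repr h x = 0 := by
  constructor
  · intro hh x hx
    have : filt R m n d ≤ LinearMap.ker ((monoBasis R m n).coord x) := by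
      refine Submodule.span_le.mpr ?_
      rintro _ ⟨i, j, hij, rfl⟩
      rw [SetLike.mem_coe, LinearMap.mem_ker, Module.Basis.coord_apply, repr_mono, if_neg]
      omega
    exact this hh
  · intro hh
    rw [← (monoBasis R m n).sum_repr h]
    refine Submodule.sum_mem _ fun x _ => ?_
    by_cases hx : (x.1 : ℕ) + x.2 < d
    · rw [hh x hx, zero_smul]
      exact Submodule.zero_mem _
    · rw [monoBasis_apply]
      exact Submodule.smul_mem _ _ (mono_mem_filt (not_lt.mp hx))

theorem filt_anti {d e : ℕ} (h : d ≤ e) : filt R m n e ≤ filt R m n d := by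
  refine Submodule.span_mono ?_
  rintro _ ⟨i, j, hij, rfl⟩
  exact ⟨i, j, h.trans hij, rfl⟩

theorem filt_eq_bot {d : ℕ} (h : m + n ≤ d + 1) : filt R m n d = ⊥ := by
  rw [eq_bot_iff, filt, Submodule.span_le]
  rintro _ ⟨i, j, hij, rfl⟩
  by_cases hi : m ≤ i
  · exact mono_eq_zero_left j hi
  · exact mono_eq_zero_right i (by omega)

theorem filt_zero [Nontrivial R] : filt R m n 0 = ⊤ :=
  eq_top_iff.mpr fun _ _ => mem_filt_iff.mpr fun _ h => absurd h (Nat.not_lt_zero _)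

theorem mono_mul_mem_filt (a b : ℕ) {d e : ℕ} (he : e ≤ d + a + b) {h : TT R m n}
    (hh : h ∈ filt R m n d) : mono R m n a b * h ∈ filt R m n e := by
  have : filt R m n d ≤ (filt R m n e).comap (LinearMap.mulLeft R (mono R m n a b)) := by
    refine Submodule.span_le.mpr ?_
    rintro _ ⟨i, j, hij, rfl⟩
    rw [SetLike.mem_coe, Submodule.mem_comap, LinearMap.mulLeft_apply, mono_mul_mono]
    exact mono_mem_filt (by omega)
  exact this hh

theorem mul_mem_filt [Nontrivial R] (y : TT R m n) {d : ℕ} {h : TT R m n}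
    (hh : h ∈ filt R m n d) : y * h ∈ filt R m n d := by
  rw [← (monoBasis R m n).sum_repr y, Finset.sum_mul]
  refine Submodule.sum_mem _ fun x _ => ?_
  rw [smul_mul_assoc, monoBasis_apply]
  exact Submodule.smul_mem _ _ (mono_mul_mem_filt _ _ (by omega) hh)

/-- The element `s + t + st`; multiplication by it is `Δ`. -/
def xel (R : Type) [CommRing R] (m n : ℕ) : TT R m n :=
  mono R m n 1 0 + mono R m n 0 1 + mono R m n 1 1

/-- The initial form `s + t` of `s + t + st`. -/
def lel (R : Type) [CommRing R] (m n : ℕ) : TT R m n :=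
  mono R m n 1 0 + mono R m n 0 1

theorem lel_mul_mem {d : ℕ} {h : TT R m n} (hh : h ∈ filt R m n d) :
    lel R m n * h ∈ filt R m n (d + 1) := by
  rw [lel, add_mul]
  exact Submodule.add_mem _ (mono_mul_mem_filt _ _ (by omega) hh)
    (mono_mul_mem_filt _ _ (by omega) hh)

theorem xel_mul_mem {d : ℕ} {h : TT R m n} (hh : h ∈ filt R m n d) :
    xel R m n * h ∈ filt R m n (d + 1) := by
  rw [xel, ← lel, add_mul]
  exact Submodule.add_mem _ (lel_mul_mem hh) (mono_mul_mem_filt _ _ (by omega) hh)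

theorem xel_pow_mul_mem {d : ℕ} (k : ℕ) {h : TT R m n} (hh : h ∈ filt R m n d) :
    xel R m n ^ k * h ∈ filt R m n (d + k) := by
  induction k with
  | zero => simpa using hh
  | succ k ih =>
    rw [pow_succ', mul_assoc, ← add_assoc]
    exact xel_mul_mem ih

theorem xel_pow_sub_lel_pow_mem {d : ℕ} (k : ℕ) {h : TT R m n} (hh : h ∈ filt R m n d) :
    xel R m n ^ k * h - lel R m n ^ k * h ∈ filt R m n (d + k + 1) := by
  induction k with
  | zero => simp
  | succ k ih =>
    have h1 : xel R m n ^ (k + 1) * h - lel R m n ^ (k + 1) * h =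
        mono R m n 1 1 * (xel R m n ^ k * h) +
          lel R m n * (xel R m n ^ k * h - lel R m n ^ k * h) := by
      rw [pow_succ', pow_succ', show xel R m n = lel R m n + mono R m n 1 1 from rfl]
      ring
    rw [h1]
    exact Submodule.add_mem _ (mono_mul_mem_filt _ _ (by omega) (xel_pow_mul_mem k hh))
      (lel_mul_mem ih)

/-- The relation x s^i t^j = (1+t) s^(i+1) t^j + s^i t^(j+1), with 1+t a unit, trades a factor s for
a factor t modulo the image of x, until t^n = 0 is reached. -/
theorem exists_eq_xel_mul [Nontrivial R] {e : ℕ} (he : n ≤ e + 1) {h : TT R m n}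
    (hh : h ∈ filt R m n (e + 1)) : ∃ y ∈ filt R m n e, xel R m n * y = h := by
  obtain ⟨u, hu⟩ : IsUnit (1 + mono R m n 0 1) :=
    IsNilpotent.isUnit_one_add ⟨n, by rw [mono_pow]; exact mono_eq_zero_right _ (by simp)⟩
  have hmono : ∀ k i j : ℕ, n ≤ j + k → e + 1 ≤ i + j →
      ∃ y ∈ filt R m n e, xel R m n * y = mono R m n i j := by
    intro k
    induction k with
    | zero =>
      intro i j hj _
      exact ⟨0, Submodule.zero_mem _, by
        rw [mul_zero, mono_eq_zero_right i (show n ≤ j by omega)]⟩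
    | succ k ih =>
      intro i j hj hij
      by_cases hjn : n ≤ j
      · exact ⟨0, Submodule.zero_mem _, by rw [mul_zero, mono_eq_zero_right i hjn]⟩
      -- A factor s is available because i + j ≥ e + 1 ≥ n > j.
      obtain ⟨i, rfl⟩ : ∃ i', i = i' + 1 := ⟨i - 1, by omega⟩
      obtain ⟨y, hy, hxy⟩ := ih i (j + 1) (by omega) (by omega)
      refine ⟨(↑u⁻¹ : TT R m n) * (mono R m n i j - y), mul_mem_filt _
        (Submodule.sub_mem _ (mono_mem_filt (by omega)) hy), ?_⟩
      have h1 : xel R m n * mono R m n i j =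
          u * mono R m n (i + 1) j + mono R m n i (j + 1) := by
        rw [hu, xel]
        simp only [add_mul, one_mul, mono_mul_mono]
        rw [add_comm 1 i, add_comm 1 j, zero_add, zero_add, zero_add]
        ring
      rw [mul_left_comm, mul_sub, h1, hxy, add_sub_cancel_right, Units.inv_mul_cancel_left]
  have : filt R m n (e + 1) ≤ (filt R m n e).map (LinearMap.mulLeft R (xel R m n)) := by
    refine Submodule.span_le.mpr ?_
    rintro _ ⟨i, j, hij, rfl⟩
    exact hmono n i j (by omega) hij
  exact this hh

theorem exists_eq_xel_pow_mul [Nontrivial R] {e : ℕ} (he : n ≤ e + 1) (k : ℕ) {h : TT R m n}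
    (hh : h ∈ filt R m n (e + k)) : ∃ y ∈ filt R m n e, xel R m n ^ k * y = h := by
  induction k generalizing h with
  | zero => exact ⟨h, hh, by simp⟩
  | succ k ih =>
    obtain ⟨y, hy, rfl⟩ := exists_eq_xel_mul (e := e + k) (by omega) hh
    obtain ⟨z, hz, rfl⟩ := ih hy
    exact ⟨z, hz, by ring⟩

/-- The homogenization of a polynomial in degree `e`. -/
def homogenize (R : Type) [CommRing R] (m n e : ℕ) (f : R[X]) : TT R m n :=
  ∑ x ∈ Finset.HasAntidiagonal.antidiagonal e, f.coeff x.1 • mono R m n x.1 x.2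

theorem homogenize_add (e : ℕ) (f g : R[X]) :
    homogenize R m n e (f + g) = homogenize R m n e f + homogenize R m n e g := by
  simp [homogenize, add_smul, Finset.sum_add_distrib]

theorem homogenize_smul (e : ℕ) (c : R) (f : R[X]) :
    homogenize R m n e (c • f) = c • homogenize R m n e f := by
  simp [homogenize, mul_smul, Finset.smul_sum]

theorem homogenize_mem (e : ℕ) (f : R[X]) : homogenize R m n e f ∈ filt R m n e := by
  refine Submodule.sum_mem _ fun x hx => Submodule.smul_mem _ _ (mono_mem_filt ?_)
  rw [Finset.HasAntidiagonal.mem_antidiagonal.mp hx]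

theorem homogenize_X_pow (i j : ℕ) :
    homogenize R m n (i + j) (Polynomial.X ^ i) = mono R m n i j := by
  rw [homogenize, Finset.sum_eq_single (i, j)]
  · simp
  · rintro ⟨a, b⟩ hab hne
    rw [Finset.HasAntidiagonal.mem_antidiagonal] at hab
    rw [Polynomial.coeff_X_pow, if_neg, zero_smul]
    rintro rfl
    exact hne (by simp at hab ⊢; exact hab)
  · simp

theorem repr_homogenize [Nontrivial R] (f : R[X]) (x : Fin m × Fin n) :
    (monoBasis R m n).repr (homogenize R m n (x.1 + x.2) f) x = f.coeff x.1 := by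
  rw [homogenize, map_sum, Finsupp.finsetSum_apply,
    Finset.sum_eq_single ((x.1 : ℕ), (x.2 : ℕ))]
  · rw [map_smul, Finsupp.smul_apply, repr_mono]
    simp
  · rintro ⟨a, b⟩ _ hne
    rw [map_smul, Finsupp.smul_apply, repr_mono, if_neg, smul_zero]
    rintro ⟨rfl, rfl⟩
    exact hne rfl
  · simp

/-- With t set to 1, the form s + t becomes 1 + X. The degree bound keeps the pure power of s from
being lost in the shift. -/
theorem lel_mul_homogenize {e : ℕ} {f : R[X]} (hf : f.natDegree ≤ e) :
    lel R m n * homogenize R m n e f =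
      homogenize R m n (e + 1) ((1 + Polynomial.X) * f) := by
  rw [add_mul 1, one_mul, homogenize_add, lel, add_mul, add_comm]
  congr 1
  · rw [homogenize, homogenize, Finset.Nat.sum_antidiagonal_succ', Finset.mul_sum]
    simp only
    rw [Polynomial.coeff_eq_zero_of_natDegree_lt (by omega), zero_smul, zero_add]
    refine Finset.sum_congr rfl fun x _ => ?_
    rw [mul_smul_comm, mono_mul_mono, zero_add, add_comm 1]
  · rw [homogenize, homogenize, Finset.Nat.sum_antidiagonal_succ, Finset.mul_sum]
    simp only [Polynomial.coeff_X_mul_zero, zero_smul, zero_add, Polynomial.coeff_X_mul]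
    refine Finset.sum_congr rfl fun x _ => ?_
    rw [mul_smul_comm, mono_mul_mono, zero_add, add_comm 1]

theorem natDegree_one_add_X_pow_mul_le {e : ℕ} {f : R[X]} (hf : f.natDegree ≤ e) (k : ℕ) :
    ((1 + Polynomial.X) ^ k * f).natDegree ≤ e + k := by
  have h1 : ((1 + Polynomial.X : R[X])).natDegree ≤ 1 := by
    exact Polynomial.natDegree_add_le_of_degree_le (by simp) Polynomial.natDegree_X_le
  have := Polynomial.natDegree_pow_le_of_le k h1
  have := Polynomial.natDegree_mul_le_of_le this hf
  omega

theorem lel_pow_mul_homogenize {e : ℕ} {f : R[X]} (hf : f.natDegree ≤ e) (k : ℕ) :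
    lel R m n ^ k * homogenize R m n e f =
      homogenize R m n (e + k) ((1 + Polynomial.X) ^ k * f) := by
  induction k with
  | zero => simp
  | succ k ih =>
    rw [pow_succ', mul_assoc, ih, lel_mul_homogenize (natDegree_one_add_X_pow_mul_le hf k),
      ← mul_assoc, ← pow_succ', add_assoc]

theorem exists_sub_homogenize_mem {e : ℕ} {h : TT R m n} (hh : h ∈ filt R m n e) :
    ∃ f : R[X], f.natDegree ≤ e ∧ h - homogenize R m n e f ∈ filt R m n (e + 1) := by
  induction hh using Submodule.span_induction with
  | mem x hx =>
    obtain ⟨i, j, hij, rfl⟩ := hx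
    rcases hij.eq_or_lt with rfl | hlt
    · refine ⟨Polynomial.X ^ i, (Polynomial.natDegree_X_pow_le i).trans (by omega), ?_⟩
      rw [homogenize_X_pow, sub_self]
      exact Submodule.zero_mem _
    · exact ⟨0, by simp, by simpa [homogenize] using mono_mem_filt hlt⟩
  | zero => exact ⟨0, by simp, by simp [homogenize]⟩
  | add x y _ _ hx hy =>
    obtain ⟨f, hf, hfx⟩ := hx
    obtain ⟨g, hg, hgy⟩ := hy
    refine ⟨f + g, Polynomial.natDegree_add_le_of_degree_le hf hg, ?_⟩
    rw [homogenize_add, add_sub_add_comm]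
    exact Submodule.add_mem _ hfx hgy
  | smul a x _ hx =>
    obtain ⟨f, hf, hfx⟩ := hx
    refine ⟨a • f, (Polynomial.natDegree_smul_le a f).trans hf, ?_⟩
    rw [homogenize_smul, ← smul_sub]
    exact Submodule.smul_mem _ _ hfx

end Coordinates

/-! ### The Lefschetz property of s + t and its filtered version -/

section Lefschetz

variable {K : Type} [Field K]

/-- If the product of `(1 + X) ^ (u + v)` with a polynomial of degree at most `r` has no terms of
degree `u, …, u + r`, then the polynomial is zero. -/
theorem eq_zero_of_coeff_one_add_X_pow_mul {u v r : ℕ} (hK : ((u + v + r).factorial : K) ≠ 0)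
    {f : K[X]} (hf : f.natDegree ≤ r)
    (h0 : ∀ b ≤ r, ((1 + Polynomial.X) ^ (u + v) * f).coeff (u + b) = 0) : f = 0 := by
  set P := (1 + Polynomial.X) ^ (u + v) * f with hP
  have hPdeg : P.natDegree ≤ r + (u + v) := natDegree_one_add_X_pow_mul_le hf _
  have hmonic : (1 + Polynomial.X : K[X]).Monic := by
    rw [add_comm]; exact Polynomial.monic_X_add_C 1
  have hdeg1 : (1 + Polynomial.X : K[X]).natDegree = 1 := by
    rw [add_comm]; exact Polynomial.natDegree_X_add_C 1
  -- The u-th derivative has degree at most v + r, yet is divisible by both (1+X)^v and X^(r+1),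
  -- which are coprime. Hence it vanishes.
  set Q := Polynomial.derivative^[u] P with hQ
  have hQc : ∀ k, Q.coeff k = ((k + u).descFactorial u : K) * P.coeff (k + u) := fun k => by
    rw [hQ, Polynomial.coeff_iterate_derivative, nsmul_eq_mul]
  have hQdeg : Q.natDegree ≤ v + r := by
    rw [Polynomial.natDegree_le_iff_coeff_eq_zero]
    intro k hk
    rw [hQc, Polynomial.coeff_eq_zero_of_natDegree_lt (by omega), mul_zero]
  have hQX : Polynomial.X ^ (r + 1) ∣ Q := by
    rw [Polynomial.X_pow_dvd_iff]
    intro k hk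
    rw [hQc, add_comm k u, h0 k (by omega), mul_zero]
  have hQ1 : (1 + Polynomial.X) ^ v ∣ Q := by
    have := Polynomial.pow_sub_dvd_iterate_derivative_of_pow_dvd u (Dvd.intro f hP.symm)
    rwa [Nat.add_sub_cancel_left] at this
  have hcop : IsCoprime ((1 + Polynomial.X : K[X]) ^ v) (Polynomial.X ^ (r + 1)) :=
    IsCoprime.pow ⟨1, -1, by ring⟩
  have hQ0 : Q = 0 := by
    by_contra hne
    have := Polynomial.natDegree_le_of_dvd (hcop.mul_dvd hQ1 hQX) hne
    rw [(hmonic.pow v).natDegree_mul (Polynomial.monic_X_pow _), hmonic.natDegree_pow,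
      Polynomial.natDegree_X_pow, hdeg1] at this
    omega
  -- The factors introduced by differentiation divide (u+v+r)!, so they are invertible, and P has no
  -- terms of degree ≥ u. A nonzero f would give P degree at least u + v.
  have hPcoeff : ∀ k, P.coeff (k + u) = 0 := by
    intro k
    by_cases hk : k + u ≤ u + v + r
    · have h1 := hQc k
      rw [hQ0, Polynomial.coeff_zero] at h1
      refine (mul_eq_zero.mp h1.symm).resolve_left fun h2 => hK ?_
      have h3 : (k + u).descFactorial u ∣ (u + v + r).factorial :=
        (Dvd.intro_left _ (Nat.factorial_mul_descFactorial (Nat.le_add_left u k))).trans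
          (Nat.factorial_dvd_factorial hk)
      obtain ⟨c, hc⟩ := h3
      rw [hc, Nat.cast_mul, h2, zero_mul]
    · exact Polynomial.coeff_eq_zero_of_natDegree_lt (by omega)
  by_contra hf0
  have hP0 : P ≠ 0 := mul_ne_zero (hmonic.pow _).ne_zero hf0
  have h1 : P.natDegree = u + v + f.natDegree := by
    rw [hP, (hmonic.pow _).natDegree_mul' hf0, hmonic.natDegree_pow, hdeg1, mul_one]
  have h2 := hPcoeff (v + f.natDegree)
  rw [show v + f.natDegree + u = P.natDegree by omega, Polynomial.coeff_natDegree] at h2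
  exact hP0 (Polynomial.leadingCoeff_eq_zero.mp h2)

/-- Prescribing r+1 coefficients is a square linear system, so the injectivity just proved gives
solvability. -/
theorem exists_coeff_one_add_X_pow_mul {u v r : ℕ} (hK : ((u + v + r).factorial : K) ≠ 0)
    (c : ℕ → K) : ∃ f : K[X], f.natDegree ≤ r ∧
      ∀ b ≤ r, ((1 + Polynomial.X) ^ (u + v) * f).coeff (u + b) = c b := by
  let E := Polynomial.degreeLTEquiv K (r + 1)
  let L : (Fin (r + 1) → K) →ₗ[K] (Fin (r + 1) → K) :=
    LinearMap.pi fun b => Polynomial.lcoeff K (u + b) ∘ₗ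
      LinearMap.mulLeft K ((1 + Polynomial.X) ^ (u + v)) ∘ₗ
        (Polynomial.degreeLT K (r + 1)).subtype ∘ₗ E.symm.toLinearMap
  have hL : ∀ g b, L g b = ((1 + Polynomial.X) ^ (u + v) * (E.symm g : K[X])).coeff (u + b) :=
    fun _ _ => rfl
  have hdeg : ∀ g, (E.symm g : K[X]).natDegree ≤ r := fun g => by
    have := Polynomial.mem_degreeLT.mp (E.symm g).2
    exact Polynomial.natDegree_le_iff_coeff_eq_zero.mpr fun k hk =>
      (Polynomial.degree_lt_iff_coeff_zero _ _).mp this k hk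
  have hinj : Function.Injective L := by
    rw [injective_iff_map_eq_zero]
    intro g hg
    have := eq_zero_of_coeff_one_add_X_pow_mul hK (hdeg g) fun b hb => by
      rw [← hL g ⟨b, Nat.lt_succ_iff.mpr hb⟩, hg, Pi.zero_apply]
    exact E.symm.map_eq_zero_iff.mp (Subtype.ext this)
  obtain ⟨g, hg⟩ := LinearMap.injective_iff_surjective.mp hinj (fun b => c b)
  refine ⟨E.symm g, hdeg g, fun b hb => ?_⟩
  rw [← hL g ⟨b, Nat.lt_succ_iff.mpr hb⟩, hg]

variable {m n u v r : ℕ}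

/-- Multiplication by `(s + t + st) ^ (m + n - 2r - 2)` is injective from degree `r`
to degree `m + n - r - 2`. -/
theorem mem_filt_of_xel_pow_mul_mem (hm : m = u + r + 1) (hn : n = v + r + 1)
    (hK : ((u + v + r).factorial : K) ≠ 0) {h : TT K m n} (hh : h ∈ filt K m n r)
    (hx : xel K m n ^ (u + v) * h ∈ filt K m n (u + v + r + 1)) : h ∈ filt K m n (r + 1) := by
  obtain ⟨f, hf, hhf⟩ := exists_sub_homogenize_mem hh
  have h1 : homogenize K m n (r + (u + v)) ((1 + Polynomial.X) ^ (u + v) * f) ∈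
      filt K m n (r + (u + v) + 1) := by
    rw [← lel_pow_mul_homogenize hf]
    have e1 := xel_pow_sub_lel_pow_mem (u + v) (homogenize_mem (m := m) (n := n) r f)
    have e2 := xel_pow_mul_mem (u + v) hhf
    rw [mul_sub] at e2
    rw [show u + v + r + 1 = r + (u + v) + 1 by omega] at hx
    rw [show r + 1 + (u + v) = r + (u + v) + 1 by omega] at e2
    have := Submodule.sub_mem _ (Submodule.sub_mem _ hx e2) e1
    simpa using this
  have hf0 : f = 0 := by
    refine eq_zero_of_coeff_one_add_X_pow_mul hK hf fun b hb => ?_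
    -- The monomials of degree u+v+r with exponents below m and n are s^(u+b) t^(v+r-b), 0 ≤ b ≤ r;
    -- these are the coefficients that must vanish.
    have h2 := mem_filt_iff.mp h1 (⟨u + b, by omega⟩, ⟨v + (r - b), by omega⟩)
      (by simp only; omega)
    have h3 := repr_homogenize (m := m) (n := n) ((1 + Polynomial.X) ^ (u + v) * f)
      (⟨u + b, by omega⟩, ⟨v + (r - b), by omega⟩)
    simp only at h3
    rw [show u + b + (v + (r - b)) = r + (u + v) by omega, h2] at h3
    exact h3.symm
  rw [hf0] at hhf
  simpa [homogenize] using hhf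

theorem exists_sub_xel_pow_mul_mem (hm : m = u + r + 1) (hn : n = v + r + 1)
    (hK : ((u + v + r).factorial : K) ≠ 0) {h : TT K m n} (hh : h ∈ filt K m n (u + v + r)) :
    ∃ y ∈ filt K m n r, h - xel K m n ^ (u + v) * y ∈ filt K m n (u + v + r + 1) := by
  obtain ⟨g, hg, hhg⟩ := exists_sub_homogenize_mem hh
  obtain ⟨f, hf, hfg⟩ := exists_coeff_one_add_X_pow_mul hK (fun b => g.coeff (u + b))
  refine ⟨homogenize K m n r f, homogenize_mem r f, ?_⟩
  have h1 : homogenize K m n (u + v + r) g = lel K m n ^ (u + v) * homogenize K m n r f := by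
    rw [lel_pow_mul_homogenize hf, add_comm r]
    refine Finset.sum_congr rfl fun x hx => ?_
    rw [Finset.HasAntidiagonal.mem_antidiagonal] at hx
    -- Only the coefficients u, …, u+r were matched; the monomials at all other positions are zero.
    by_cases h1 : x.1 < m
    · by_cases h2 : x.2 < n
      · obtain ⟨b, hb⟩ : ∃ b, x.1 = u + b := ⟨x.1 - u, by omega⟩
        rw [hb, hfg b (by omega)]
      · rw [mono_eq_zero_right _ (not_lt.mp h2), smul_zero, smul_zero]
    · rw [mono_eq_zero_left _ (not_lt.mp h1), smul_zero, smul_zero]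
  have e1 := xel_pow_sub_lel_pow_mem (u + v) (homogenize_mem (m := m) (n := n) r f)
  rw [h1] at hhg
  rw [add_comm r] at e1
  have := Submodule.sub_mem _ hhg e1
  simpa using this

/-- Multiplication by `(s + t + st) ^ (m + n - 2r - 2)` maps the filtration step `r` onto the
filtration step `m + n - r - 2`. -/
theorem exists_xel_pow_mul_eq (hm : m = u + r + 1) (hn : n = v + r + 1)
    (hK : ((u + v + r).factorial : K) ≠ 0) {h : TT K m n} (hh : h ∈ filt K m n (u + v + r)) :
    ∃ y ∈ filt K m n r, xel K m n ^ (u + v) * y = h := by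
  -- Successive approximation: an error in step u+v+r+k is x^k z with z in step u+v+r, and the
  -- leading part of z is corrected by the graded statement. The filtration is finite, so the error
  -- dies.
  have key : ∀ k, ∃ y ∈ filt K m n r,
      h - xel K m n ^ (u + v) * y ∈ filt K m n (u + v + r + k) := by
    intro k
    induction k with
    | zero => exact ⟨0, Submodule.zero_mem _, by simpa using hh⟩
    | succ k ih =>
      obtain ⟨y, hy, hyk⟩ := ih
      obtain ⟨z, hz, hzk⟩ := exists_eq_xel_pow_mul (by omega) k hyk
      obtain ⟨w, hw, hwz⟩ := exists_sub_xel_pow_mul_mem hm hn hK hz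
      refine ⟨y + xel K m n ^ k * w, Submodule.add_mem _ hy (mul_mem_filt _ hw), ?_⟩
      have h1 : h - xel K m n ^ (u + v) * (y + xel K m n ^ k * w) =
          xel K m n ^ k * (z - xel K m n ^ (u + v) * w) := by
        rw [mul_sub, hzk]
        ring
      rw [h1, show u + v + r + (k + 1) = u + v + r + 1 + k by omega]
      exact xel_pow_mul_mem k hwz
  obtain ⟨y, hy, hyk⟩ := key (m + n)
  rw [filt_eq_bot (by omega), Submodule.mem_bot, sub_eq_zero] at hyk
  exact ⟨y, hy, hyk.symm⟩

/-- Elements with distinct lowest degrees are linearly independent. -/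
theorem linearIndependent_of_lowDegree {ι : Type} [Fintype ι] (w : ι → TT K m n) (d : ι → ℕ)
    (hd : Function.Injective d) (hw : ∀ i, HasLowDegree (w i) (d i)) :
    LinearIndependent K w := by
  classical
  rw [Fintype.linearIndependent_iff]
  intro c hc
  by_contra! hne
  obtain ⟨i₀, hi₀⟩ := hne
  obtain ⟨i, hi, hmin⟩ := Finset.exists_min_image (Finset.univ.filter fun i => c i ≠ 0) d
    ⟨i₀, by simpa using hi₀⟩
  have hci : c i ≠ 0 := by simpa using hi
  rw [← Finset.add_sum_erase _ _ (Finset.mem_univ i)] at hc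
  have h1 : ∑ j ∈ Finset.univ.erase i, c j • w j ∈ filt K m n (d i + 1) := by
    refine Submodule.sum_mem _ fun j hj => ?_
    by_cases hcj : c j = 0
    · rw [hcj, zero_smul]
      exact Submodule.zero_mem _
    · have h2 := hmin j (by simpa using hcj)
      have h3 : d i ≠ d j := fun h => (Finset.mem_erase.mp hj).1 (hd h).symm
      exact Submodule.smul_mem _ _ (filt_anti (by omega) (hw j).1)
  rw [eq_neg_of_add_eq_zero_right hc, Submodule.neg_mem_iff] at h1
  exact (hw i).2 ((Submodule.smul_mem_iff _ hci).mp h1)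

end Lefschetz

/-! ### Δ as multiplication by s + t + st -/

section Delta

theorem xel_eq (R : Type) [CommRing R] (m n : ℕ) :
    xel R m n = ((1 + tvar R m) ⊗ₜ[R] (1 + tvar R n)) - 1 := by
  simp only [xel, mono, TensorProduct.add_tmul, TensorProduct.tmul_add, pow_one, pow_zero,
    Algebra.TensorProduct.one_def]
  abel

theorem deltaM_eq (R : Type) [CommRing R] (m n : ℕ) :
    deltaM R m n = LinearMap.mulLeft R (xel R m n) := by
  refine TensorProduct.ext' fun a b => ?_
  rw [LinearMap.mulLeft_apply, xel_eq, sub_mul, one_mul, Algebra.TensorProduct.tmul_mul_tmul]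
  simp [deltaM, delta, repMM, repM, sigmaUnit, add_mul]

theorem deltaV_eq (p : ℕ) [Fact p.Prime] (m n : ℕ) (hm : m ≤ p) (hn : n ≤ p) :
    deltaV p m n hm hn = LinearMap.mulLeft (ZMod p) (xel (ZMod p) m n) := by
  refine TensorProduct.ext' fun a b => ?_
  rw [LinearMap.mulLeft_apply, xel_eq, sub_mul, one_mul, Algebra.TensorProduct.tmul_mul_tmul]
  simp [deltaV, delta, repVV, repV, ZMod.val_one, add_mul]

theorem deltaM_pow_apply (R : Type) [CommRing R] (m n k : ℕ) (h : TT R m n) :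
    (deltaM R m n ^ k) h = xel R m n ^ k * h := by
  rw [deltaM_eq, LinearMap.pow_mulLeft, LinearMap.mulLeft_apply]

theorem deltaV_pow_apply (p : ℕ) [Fact p.Prime] (m n : ℕ) (hm : m ≤ p) (hn : n ≤ p) (k : ℕ)
    (h : TT (ZMod p) m n) : (deltaV p m n hm hn ^ k) h = xel (ZMod p) m n ^ k * h := by
  rw [deltaV_eq, LinearMap.pow_mulLeft, LinearMap.mulLeft_apply]

/-- 1 + x = (1+s) ⊗ (1+t) has p-th power 1, and the p-th power is additive in characteristic p. -/
theorem xel_pow_prime (p : ℕ) [Fact p.Prime] (m n : ℕ) (hm : m ≤ p) (hn : n ≤ p) :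
    xel (ZMod p) m n ^ p = 0 := by
  have h1 : (1 + xel (ZMod p) m n) ^ p = 1 := by
    rw [xel_eq, add_sub_cancel, Algebra.TensorProduct.tmul_pow, one_add_tvar_pow p m hm,
      one_add_tvar_pow p n hn, Algebra.TensorProduct.one_def]
  obtain ⟨y, hy⟩ := exists_add_pow_prime_eq (Fact.out : p.Prime) (1 : TT (ZMod p) m n)
    (xel (ZMod p) m n)
  have hp : (p : TT (ZMod p) m n) = 0 := by
    rw [← map_natCast (algebraMap (ZMod p) (TT (ZMod p) m n)) p, ZMod.natCast_self, map_zero]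
  rw [h1, hp] at hy
  simpa using hy

end Delta

/-! ### Base change from the integral lattice -/

section Cast

variable {S : Type} [CommRing S] {m n : ℕ}

theorem castTT_mono (i j : ℕ) : castTT S m n (mono ℤ m n i j) = mono S m n i j := by
  simp [mono, castTT_tmul, castOne, tvar]

theorem castTT_xel : castTT S m n (xel ℤ m n) = xel S m n := by
  simp only [xel, map_add, castTT_mono]

theorem castTT_smul (a : ℤ) (h : TT ℤ m n) :
    castTT S m n (a • h) = (a : S) • castTT S m n h := by
  rw [map_zsmul, Int.cast_smul_eq_zsmul]

theorem repr_castTT [Nontrivial S] (h : TT ℤ m n) (x : Fin m × Fin n) :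
    (monoBasis S m n).repr (castTT S m n h) x = (((monoBasis ℤ m n).repr h x : ℤ) : S) := by
  have h1 : castTT S m n h = ∑ y, (((monoBasis ℤ m n).repr h y : ℤ) : S) • monoBasis S m n y := by
    conv_lhs => rw [← (monoBasis ℤ m n).sum_repr h]
    rw [map_sum]
    refine Finset.sum_congr rfl fun y _ => ?_
    rw [castTT_smul, monoBasis_apply, monoBasis_apply, castTT_mono]
  rw [h1, Module.Basis.repr_sum_self]

theorem castTT_mem_filt [Nontrivial S] {d : ℕ} {h : TT ℤ m n} (hh : h ∈ filt ℤ m n d) :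
    castTT S m n h ∈ filt S m n d := by
  rw [mem_filt_iff] at hh ⊢
  intro x hx
  rw [repr_castTT, hh x hx, Int.cast_zero]

theorem castTT_injective [CharZero S] : Function.Injective (castTT S m n) := by
  have : Nontrivial S := ⟨0, 1, by exact_mod_cast (Nat.cast_injective (R := S)).ne zero_ne_one⟩
  rw [injective_iff_map_eq_zero]
  intro h hh
  refine (monoBasis ℤ m n).ext_elem fun x => ?_
  have := repr_castTT (S := S) h x
  rw [hh, map_zero, Finsupp.zero_apply] at this
  rw [map_zero, Finsupp.zero_apply]
  exact_mod_cast this.symm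

/-- Filtration steps are given by vanishing coordinates, so dividing every coordinate by p does not
leave the step. -/
theorem exists_eq_smul_of_red_eq_zero {p : ℕ} [Fact p.Prime] {d : ℕ} {h : TT ℤ m n}
    (hh : h ∈ filt ℤ m n d) (h0 : red p m n h = 0) :
    ∃ h' ∈ filt ℤ m n d, h = (p : ℤ) • h' := by
  have hdvd : ∀ x, (p : ℤ) ∣ (monoBasis ℤ m n).repr h x := by
    intro x
    have := repr_castTT (S := ZMod p) h x
    rw [h0, map_zero, Finsupp.zero_apply] at this
    exact (ZMod.intCast_zmod_eq_zero_iff_dvd _ p).mp this.symm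
  choose c hc using hdvd
  have hrepr : ∀ x, (monoBasis ℤ m n).repr (∑ x, c x • monoBasis ℤ m n x) x = c x :=
    fun x => by rw [Module.Basis.repr_sum_self]
  refine ⟨∑ x, c x • monoBasis ℤ m n x, ?_, ?_⟩
  · rw [mem_filt_iff] at hh ⊢
    intro x hx
    rw [hrepr]
    have h1 := hh x hx
    rw [hc] at h1
    exact (mul_eq_zero.mp h1).resolve_left (by exact_mod_cast (Fact.out : p.Prime).ne_zero)
  · refine (monoBasis ℤ m n).ext_elem fun x => ?_
    rw [map_smul, Finsupp.smul_apply, hrepr, hc, smul_eq_mul]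

theorem exists_red_eq {p : ℕ} [Fact p.Prime] {d : ℕ} {y : TT (ZMod p) m n}
    (hy : y ∈ filt (ZMod p) m n d) : ∃ h ∈ filt ℤ m n d, red p m n h = y := by
  induction hy using Submodule.span_induction with
  | mem x hx =>
    obtain ⟨i, j, hij, rfl⟩ := hx
    exact ⟨mono ℤ m n i j, mono_mem_filt hij, castTT_mono i j⟩
  | zero => exact ⟨0, Submodule.zero_mem _, map_zero _⟩
  | add x y _ _ hx hy =>
    obtain ⟨a, ha, rfl⟩ := hx
    obtain ⟨b, hb, rfl⟩ := hy
    exact ⟨a + b, Submodule.add_mem _ ha hb, map_add _ _ _⟩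
  | smul c x _ hx =>
    obtain ⟨a, ha, rfl⟩ := hx
    obtain ⟨c, rfl⟩ := ZMod.intCast_surjective c
    exact ⟨c • a, Submodule.smul_mem _ _ ha, castTT_smul c a⟩

theorem smul_eq_zero_of_ne_zero {a : ℤ} (ha : a ≠ 0) {h : TT ℤ m n} (h0 : a • h = 0) : h = 0 := by
  refine (monoBasis ℤ m n).ext_elem fun x => ?_
  have := congrArg (fun y => (monoBasis ℤ m n).repr y x) h0
  simp only [map_zsmul, Finsupp.smul_apply, map_zero, Finsupp.zero_apply, smul_eq_mul] at this
  rw [map_zero, Finsupp.zero_apply]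
  exact (mul_eq_zero.mp this).resolve_left ha

end Cast

/-! ### Lifting Lefschetz surjectivity to the integers -/

section Lattice

variable {m n u v r : ℕ}

theorem factorial_cast_ne_zero {q k : ℕ} [Fact q.Prime] (h : k < q) :
    ((k.factorial : ℕ) : ZMod q) ≠ 0 := by
  rw [Ne, ZMod.natCast_eq_zero_iff, (Fact.out : q.Prime).dvd_factorial]
  omega

theorem filt_fg {R : Type} [CommRing R] [Nontrivial R] [IsNoetherianRing R] (d : ℕ) :
    (filt R m n d).FG := by
  have : Module.Finite R (TT R m n) := Module.Finite.of_basis (monoBasis R m n)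
  exact IsNoetherian.noetherian _

/-- Integrally, `(s + t + st) ^ (m + n - 2r - 2)` maps the filtration step `r` onto the filtration
step `m + n - r - 2` up to a factor prime to `q`, for every prime `q > m + n - r - 2`. -/
theorem exists_xel_pow_mul_eq_smul (q : ℕ) [Fact q.Prime] (hm : m = u + r + 1)
    (hn : n = v + r + 1) (hq : u + v + r < q) {h : TT ℤ m n} (hh : h ∈ filt ℤ m n (u + v + r)) :
    ∃ a : ℤ, ¬ (q : ℤ) ∣ a ∧ ∃ y ∈ filt ℤ m n r, xel ℤ m n ^ (u + v) * y = a • h := by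
  set F := filt ℤ m n (u + v + r)
  set A := (filt ℤ m n r).map (LinearMap.mulLeft ℤ (xel ℤ m n ^ (u + v)))
  -- F ⊆ A + qF: solve modulo q, lift the solution, and divide the difference by q inside F.
  have hle : F.map A.mkQ ≤ Ideal.span {(q : ℤ)} • F.map A.mkQ := by
    rintro _ ⟨z, hz, rfl⟩
    obtain ⟨y, hy, hyz⟩ := exists_xel_pow_mul_eq (K := ZMod q) hm hn (factorial_cast_ne_zero hq)
      (castTT_mem_filt hz)
    obtain ⟨w, hw, rfl⟩ := exists_red_eq hy
    have hmem : z - xel ℤ m n ^ (u + v) * w ∈ F := by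
      refine Submodule.sub_mem _ hz ?_
      have := xel_pow_mul_mem (u + v) hw
      rwa [add_comm] at this
    obtain ⟨z', hz', hzz⟩ := exists_eq_smul_of_red_eq_zero (p := q) hmem (by
      rw [map_sub, map_mul, map_pow, castTT_xel, hyz, sub_self])
    have h1 : A.mkQ z = (q : ℤ) • A.mkQ z' := by
      rw [← map_smul, ← hzz, map_sub, eq_comm, sub_eq_self, Submodule.mkQ_apply,
        Submodule.Quotient.mk_eq_zero]
      exact ⟨w, hw, rfl⟩
    rw [h1]
    exact Submodule.smul_mem_smul (Ideal.mem_span_singleton_self _) ⟨z', hz', rfl⟩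
  -- Nakayama's lemma: some integer a ≡ 1 mod q annihilates the image of F modulo A.
  obtain ⟨a, ha, haF⟩ := Submodule.exists_sub_one_mem_and_smul_eq_zero_of_fg_of_le_smul _ _
    ((filt_fg _).map A.mkQ) hle
  have h2 := haF (A.mkQ h) ⟨h, hh, rfl⟩
  rw [← map_smul, Submodule.mkQ_apply, Submodule.Quotient.mk_eq_zero] at h2
  obtain ⟨y, hy, hya⟩ := h2
  refine ⟨a, fun hdvd => ?_, y, hy, hya⟩
  rw [Ideal.mem_span_singleton] at ha
  have h3 : (q : ℤ) ∣ 1 := by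
    have := dvd_sub hdvd ha
    rwa [sub_sub_cancel] at this
  exact (Fact.out : q.Prime).one_lt.ne' (by exact_mod_cast Int.eq_one_of_dvd_one (by positivity) h3)

end Lattice

/-! ### Existence of the socle elements -/

section Socle

variable {m n : ℕ}

theorem repr_socleForm {r : ℕ} (hr : r < m) (hmn : m ≤ n) :
    (monoBasis ℤ m n).repr (∑ i ∈ Finset.range (r + 1),
      (-1 : ℤ) ^ i • mono ℤ m n (m - 1 - i) (n - 1 - r + i))
      (⟨m - 1, by omega⟩, ⟨n - 1 - r, by omega⟩) = 1 := by
  rw [map_sum, Finsupp.finsetSum_apply, Finset.sum_eq_single 0]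
  · rw [map_smul, Finsupp.smul_apply, repr_mono, if_pos (by simp)]
    simp
  · intro i _ hi
    rw [map_smul, Finsupp.smul_apply, repr_mono, if_neg, smul_zero]
    simp only
    omega
  · simp

theorem exists_isSocleFamily (hmn : m ≤ n) : ∃ ω : ℕ → TT ℤ m n, IsSocleFamily m n ω := by
  obtain ⟨u, hu⟩ : IsUnit (1 + mono ℤ m n 1 0) :=
    IsNilpotent.isUnit_one_add ⟨m, by rw [mono_pow]; exact mono_eq_zero_left _ (by simp)⟩
  set w : TT ℤ m n := ↑u⁻¹ with hw
  have huw : (1 + mono ℤ m n 1 0) * w = 1 := by rw [← hu, hw, Units.mul_inv]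
  set s := mono ℤ m n 1 0 with hs
  set t := mono ℤ m n 0 1 with ht
  have hst : ∀ i j, mono ℤ m n i j = s ^ i * t ^ j := by
    intro i j
    rw [hs, ht, mono_pow, mono_pow, mono_mul_mono]
    simp
  -- With w = (1+s)⁻¹ the element x is a unit times sw + t. Replacing s by sw in the prescribed form
  -- gives an element whose product with sw + t telescopes to multiples of s^m and t^n.
  have hx : xel ℤ m n = (1 + s) * (s * w + t) := by
    rw [xel, hst 1 1, pow_one, pow_one, ← hs, ← ht, mul_add, mul_left_comm, huw]
    ring
  refine ⟨fun r => ∑ i ∈ Finset.range (r + 1),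
    (-1 : ℤ) ^ i • ((s * w) ^ (m - 1 - i) * t ^ (n - 1 - r + i)), fun r hr => ⟨?_, 1, Or.inl rfl, ?_,
      ?_, ?_⟩⟩
  · have htel : ∀ i ∈ Finset.range (r + 1), (s * w + t) *
        ((-1 : ℤ) ^ i • ((s * w) ^ (m - 1 - i) * t ^ (n - 1 - r + i))) =
        (-1 : ℤ) ^ i • ((s * w) ^ (m - i) * t ^ (n - 1 - r + i)) -
        (-1 : ℤ) ^ (i + 1) • ((s * w) ^ (m - (i + 1)) * t ^ (n - 1 - r + (i + 1))) := by
      intro i hi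
      have := Finset.mem_range.mp hi
      rw [show m - i = m - 1 - i + 1 by omega, show m - (i + 1) = m - 1 - i by omega, ← add_assoc,
        mul_smul_comm, pow_succ (-1 : ℤ), mul_neg_one, neg_smul, sub_neg_eq_add, ← smul_add]
      congr 1
      ring
    rw [deltaM_eq, LinearMap.mulLeft_apply, hx, mul_assoc, Finset.mul_sum,
      Finset.sum_congr rfl htel, Finset.sum_range_sub' (fun i =>
        (-1 : ℤ) ^ i • ((s * w) ^ (m - i) * t ^ (n - 1 - r + i)))]
    have h1 : s ^ m = 0 := by
      rw [hs, mono_pow]; exact mono_eq_zero_left _ (by simp)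
    have h2 : t ^ (n - 1 - r + (r + 1)) = 0 := by
      rw [ht, mono_pow]; exact mono_eq_zero_right _ (by simp; omega)
    rw [h2, Nat.sub_zero, mul_pow s w m, h1]
    simp
  · rw [one_smul]
    refine Submodule.sum_mem _ fun i hi => Submodule.smul_mem _ _ (Submodule.subset_span ?_)
    have := Finset.mem_range.mp hi
    exact ⟨_, _, by omega, rfl⟩
  · intro h0
    have := repr_socleForm hr hmn
    rw [one_smul] at h0
    rw [h0] at this
    simp at this
  · rw [one_smul, ← Finset.sum_sub_distrib]
    refine Submodule.sum_mem _ fun i hi => ?_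
    have := Finset.mem_range.mp hi
    rw [← smul_sub]
    refine Submodule.smul_mem _ _ ?_
    have h1 : (s * w) ^ (m - 1 - i) * t ^ (n - 1 - r + i) -
        mono ℤ m n (m - 1 - i) (n - 1 - r + i) =
        mono ℤ m n (m - 1 - i) (n - 1 - r + i) * (w ^ (m - 1 - i) - 1) := by
      rw [hst]; ring
    rw [h1]
    refine mono_mul_mem_filt (d := 1) _ _ (by omega) ?_
    have h2 : w - 1 = mono ℤ m n 1 0 * (-w) := by
      rw [← hs]; linear_combination huw
    obtain ⟨y, hy⟩ := sub_one_dvd_pow_sub_one w (m - 1 - i)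
    rw [hy, mul_comm]
    refine mul_mem_filt _ ?_
    rw [h2]
    refine mono_mul_mem_filt (d := 0) _ _ (by omega) ?_
    rw [filt_zero]
    exact Submodule.mem_top

end Socle

/-! ### Existence of the integral generators -/

section Generators

variable {m n : ℕ} {ω : ℕ → TT ℤ m n}

theorem xel_mul_socle (hω : IsSocleFamily m n ω) {r : ℕ} (hr : r < m) :
    xel ℤ m n * ω r = 0 := by
  have := (hω r hr).1
  rwa [deltaM_eq, LinearMap.mulLeft_apply] at this

theorem socle_mem_filt (hω : IsSocleFamily m n ω) {r : ℕ} (hr : r < m) :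
    ω r ∈ filt ℤ m n (m + n - r - 2) := by
  obtain ⟨-, ε, -, hg, -, hsub⟩ := hω r hr
  have h1 : homog ℤ m n (m + n - r - 2) ≤ filt ℤ m n (m + n - r - 2) := by
    refine Submodule.span_mono ?_
    rintro _ ⟨i, j, hij, rfl⟩
    exact ⟨i, j, hij.ge, rfl⟩
  have := Submodule.add_mem _ (filt_anti (Nat.le_succ _) hsub) (h1 hg)
  rwa [sub_add_cancel] at this

/-- The coefficient of s^(m-1) t^(n-1-r) in ω_r is ±1, so it survives in every nontrivial ring. -/
theorem cast_socle_notMem_filt (S : Type) [CommRing S] [Nontrivial S]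
    (hω : IsSocleFamily m n ω) (hmn : m ≤ n) {r : ℕ} (hr : r < m) :
    castTT S m n (ω r) ∉ filt S m n (m + n - r - 2 + 1) := by
  obtain ⟨-, ε, hε, -, -, hsub⟩ := hω r hr
  intro hmem
  have hlt : m - 1 + (n - 1 - r) < m + n - r - 2 + 1 := by omega
  have h1 := mem_filt_iff.mp hmem (⟨m - 1, by omega⟩, ⟨n - 1 - r, by omega⟩) hlt
  have h2 := mem_filt_iff.mp hsub (⟨m - 1, by omega⟩, ⟨n - 1 - r, by omega⟩) hlt
  rw [map_sub, Finsupp.sub_apply, map_zsmul, Finsupp.smul_apply, repr_socleForm hr hmn,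
    smul_eq_mul, mul_one, sub_eq_zero] at h2
  rw [repr_castTT, h2] at h1
  rcases hε with rfl | rfl <;> simp at h1

theorem notMem_filt_of_pow_mul_eq_smul {K : Type} [Field K] {y w : TT K m n} {a : K} (ha : a ≠ 0)
    {N r d : ℕ} (hd : d ≤ r + N) (hy : xel K m n ^ N * y = a • w)
    (hw : w ∉ filt K m n (d + 1)) : y ∉ filt K m n (r + 1) := by
  intro hmem
  have := xel_pow_mul_mem N hmem
  rw [hy, Submodule.smul_mem_iff _ ha] at this
  exact hw (filt_anti (by omega) this)

theorem cast_pow_mul_eq (S : Type) [CommRing S] {y w : TT ℤ m n} {a : ℤ} {N : ℕ}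
    (h : xel ℤ m n ^ N * y = a • w) :
    xel S m n ^ N * castTT S m n y = (a : S) • castTT S m n w := by
  rw [← castTT_smul, ← h, map_mul, map_pow, castTT_xel]

theorem exists_isGeneratorFamily (p : ℕ) [Fact p.Prime] (hmn : m ≤ n)
    (hω : IsSocleFamily m n ω) : ∃ α : ℕ → TT ℤ m n, IsGeneratorFamily p m n ω α := by
  suffices ∀ r, ∃ y : TT ℤ m n, r < m → (HasLowDegree y r ∧
      (∃ a : ℤ, a ≠ 0 ∧ (deltaM ℤ m n ^ (m + n - 2 * r - 2)) y = a • ω r) ∧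
      red p m n y ≠ 0 ∧ (m + n - p ≤ r → HasLowDegree (red p m n y) r)) by
    choose α hα using this
    exact ⟨α, fun r hr => hα r hr⟩
  intro r
  by_cases hr : r < m
  swap
  · exact ⟨0, fun h => absurd h hr⟩
  obtain ⟨u, hu⟩ : ∃ u, m = u + r + 1 := ⟨m - 1 - r, by omega⟩
  obtain ⟨v, hv⟩ : ∃ v, n = v + r + 1 := ⟨n - 1 - r, by omega⟩
  have hN : m + n - 2 * r - 2 = u + v := by omega
  have hd : m + n - r - 2 = u + v + r := by omega
  have hωmem := socle_mem_filt hω hr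
  have hωp := cast_socle_notMem_filt (ZMod p) hω hmn hr
  have hωq := cast_socle_notMem_filt ℚ hω hmn hr
  rw [hd] at hωmem hωp hωq
  simp only [deltaM_pow_apply, hN]
  by_cases hc : m + n - p ≤ r
  -- Here m+n-r-2 < p, so the lifting works at p itself and a stays nonzero modulo p.
  · obtain ⟨a, ha, y, hy, hya⟩ := exists_xel_pow_mul_eq_smul p hu hv (by omega) hωmem
    have ha' : (a : ZMod p) ≠ 0 := fun h => ha ((ZMod.intCast_zmod_eq_zero_iff_dvd _ p).mp h)
    have h1 : red p m n y ∉ filt (ZMod p) m n (r + 1) :=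
      notMem_filt_of_pow_mul_eq_smul ha' (by omega) (cast_pow_mul_eq _ hya) hωp
    refine ⟨y, fun _ => ⟨⟨hy, fun h => h1 (castTT_mem_filt h)⟩, ⟨a, ?_, hya⟩, ?_,
      fun _ => ⟨castTT_mem_filt hy, h1⟩⟩⟩
    · rintro rfl
      exact ha (dvd_zero _)
    · intro h
      rw [h] at h1
      exact h1 (Submodule.zero_mem _)
  -- Here an auxiliary prime q ≥ m+n gives a solution, and one with |a| minimal is chosen. If y were
  -- divisible by p, then so would a be, since ρ(ω_r) ≠ 0, and dividing both by p would contradict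
  -- minimality.
  · have hex : ∃ k, ∃ a : ℤ, a ≠ 0 ∧ a.natAbs = k ∧ ∃ y ∈ filt ℤ m n r,
        xel ℤ m n ^ (u + v) * y = a • ω r := by
      obtain ⟨q, hq, hqp⟩ := Nat.exists_infinite_primes (m + n)
      have := Fact.mk hqp
      obtain ⟨a, ha, y, hy, hya⟩ := exists_xel_pow_mul_eq_smul q hu hv (by omega) hωmem
      exact ⟨a.natAbs, a, fun h => ha (h ▸ dvd_zero _), rfl, y, hy, hya⟩
    classical
    obtain ⟨a, ha, hak, y, hy, hya⟩ := Nat.find_spec hex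
    have h1 : incl m n y ∉ filt ℚ m n (r + 1) :=
      notMem_filt_of_pow_mul_eq_smul (a := (a : ℚ)) (by exact_mod_cast ha) (by omega)
        (cast_pow_mul_eq _ hya) hωq
    refine ⟨y, fun _ => ⟨⟨hy, fun h => h1 (castTT_mem_filt h)⟩, ⟨a, ha, hya⟩, fun hred => ?_,
      fun h => absurd h hc⟩⟩
    obtain ⟨y', hy', rfl⟩ := exists_eq_smul_of_red_eq_zero hy hred
    have hp0 : (p : ℤ) ≠ 0 := by exact_mod_cast (Fact.out : p.Prime).ne_zero
    have h2 := cast_pow_mul_eq (ZMod p) hya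
    rw [hred, mul_zero] at h2
    have h3 : (a : ZMod p) = 0 := by
      refine (smul_eq_zero.mp h2.symm).resolve_right fun h => ?_
      rw [h] at hωp
      exact hωp (Submodule.zero_mem _)
    obtain ⟨a', rfl⟩ := (ZMod.intCast_zmod_eq_zero_iff_dvd _ p).mp h3
    have ha' : a' ≠ 0 := right_ne_zero_of_mul ha
    have h4 : xel ℤ m n ^ (u + v) * y' = a' • ω r := by
      refine sub_eq_zero.mp (smul_eq_zero_of_ne_zero hp0 ?_)
      rw [smul_sub, ← mul_smul_comm, hya, mul_smul, sub_self]
    refine Nat.find_min hex (m := a'.natAbs) ?_ ⟨a', ha', rfl, y', hy', h4⟩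
    rw [← hak, Int.natAbs_mul, Int.natAbs_natCast]
    exact lt_mul_of_one_lt_left (Int.natAbs_pos.mpr ha') (Fact.out : p.Prime).one_lt

end Generators

/-! ### Dimension count, decompositions and reduction of the summands -/

section Decomposition

variable {m n : ℕ} {ω α : ℕ → TT ℤ m n}

theorem finiteDimensional_TT (K : Type) [Field K] (m n : ℕ) : FiniteDimensional K (TT K m n) :=
  Module.Finite.of_basis (monoBasis K m n)

theorem finrank_TT (K : Type) [Field K] (m n : ℕ) : Module.finrank K (TT K m n) = m * n := by
  rw [Module.finrank_eq_card_basis (monoBasis K m n)]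
  simp

theorem sum_chain_length (hmn : m ≤ n) {k : ℕ} (hk : k ≤ m) :
    ∑ r ∈ Finset.range k, (m + n - 2 * r - 1) + k * k = k * (m + n) := by
  induction k with
  | zero => simp
  | succ k ih =>
    have := ih (by omega)
    rw [Finset.sum_range_succ]
    have h1 : m + n - 2 * k - 1 + (2 * k + 1) = m + n := by omega
    linarith

theorem mem_zpowers_int (g : Multiplicative ℤ) :
    g ∈ Subgroup.zpowers (Multiplicative.ofAdd (1 : ℤ)) :=
  Subgroup.mem_zpowers_iff.mpr ⟨Multiplicative.toAdd g, by simp [← ofAdd_zsmul]⟩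

theorem mem_zpowers_zmod (p : ℕ) [Fact p.Prime] (g : Multiplicative (ZMod p)) :
    g ∈ Subgroup.zpowers (Multiplicative.ofAdd (1 : ZMod p)) :=
  Subgroup.mem_zpowers_iff.mpr ⟨((Multiplicative.toAdd g).val : ℤ), by
    rw [← ofAdd_zsmul]; simp⟩

theorem repM_apply_generator (R : Type) [CommRing R] (l : ℕ) (f : TruncPoly R l) :
    repM R l (Multiplicative.ofAdd 1) f = (1 + tvar R l) * f := by
  simp [repM, sigmaUnit, add_mul]

theorem repV_apply_generator (p : ℕ) [Fact p.Prime] (l : ℕ) (hl : l ≤ p)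
    (f : TruncPoly (ZMod p) l) :
    repV p l hl (Multiplicative.ofAdd 1) f = (1 + tvar (ZMod p) l) * f := by
  simp [repV, ZMod.val_one, add_mul]

theorem hasLowDegree_smul {K : Type} [Field K] {w : TT K m n} {d : ℕ} {a : K} (ha : a ≠ 0)
    (hw : HasLowDegree w d) : HasLowDegree (a • w) d :=
  ⟨Submodule.smul_mem _ _ hw.1, fun h => hw.2 ((Submodule.smul_mem_iff _ ha).mp h)⟩

theorem hasLowDegree_cast_socle (S : Type) [CommRing S] [Nontrivial S]
    (hω : IsSocleFamily m n ω) (hmn : m ≤ n) {r : ℕ} (hr : r < m) :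
    HasLowDegree (castTT S m n (ω r)) (m + n - r - 2) :=
  ⟨castTT_mem_filt (socle_mem_filt hω hr), cast_socle_notMem_filt S hω hmn hr⟩

theorem ne_zero_of_hasLowDegree {R : Type} [CommRing R] {w : TT R m n} {d : ℕ}
    (hw : HasLowDegree w d) : w ≠ 0 := by
  rintro rfl
  exact hw.2 (Submodule.zero_mem _)

variable {p : ℕ}

theorem exists_pow_mul_generator (hα : IsGeneratorFamily p m n ω α) {r : ℕ}
    (hr : r < m) :
    ∃ a : ℤ, a ≠ 0 ∧ xel ℤ m n ^ (m + n - 2 * r - 1 - 1) * α r = a • ω r := by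
  obtain ⟨-, ⟨a, ha, h⟩, -, -⟩ := hα r hr
  rw [deltaM_pow_apply] at h
  exact ⟨a, ha, h⟩

theorem pow_mul_generator_eq_zero (S : Type) [CommRing S] (hmn : m ≤ n)
    (hω : IsSocleFamily m n ω) (hα : IsGeneratorFamily p m n ω α) {r : ℕ} (hr : r < m) :
    xel S m n ^ (m + n - 2 * r - 1) * castTT S m n (α r) = 0 := by
  obtain ⟨a, -, h⟩ := exists_pow_mul_generator hα hr
  have h1 : xel ℤ m n ^ (m + n - 2 * r - 1) * α r = 0 := by
    rw [show m + n - 2 * r - 1 = m + n - 2 * r - 1 - 1 + 1 by omega, pow_succ', mul_assoc, h,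
      mul_smul_comm, xel_mul_socle hω hr, smul_zero]
  rw [← castTT_xel, ← map_pow, ← map_mul, h1, map_zero]

theorem hasLowDegree_last_rat (hmn : m ≤ n)
    (hω : IsSocleFamily m n ω) (hα : IsGeneratorFamily p m n ω α) {r : ℕ} (hr : r < m) :
    HasLowDegree (xel ℚ m n ^ (m + n - 2 * r - 1 - 1) * incl m n (α r)) (m + n - r - 2) := by
  obtain ⟨a, ha, h⟩ := exists_pow_mul_generator hα hr
  rw [cast_pow_mul_eq ℚ h]
  exact hasLowDegree_smul (by exact_mod_cast ha) (hasLowDegree_cast_socle ℚ hω hmn hr)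

/-- Generators of the summands modulo `p`. -/
def modGen (p m n : ℕ) (α : ℕ → TT ℤ m n) :
    Finset.Ico (m + n - p) m ⊕ Fin (m + n - p) → TT (ZMod p) m n :=
  Sum.elim (fun r => red p m n (α r)) (fun k => mono (ZMod p) m n k 0)

/-- Dimensions of the summands modulo `p`. -/
def modLen (p m n : ℕ) : Finset.Ico (m + n - p) m ⊕ Fin (m + n - p) → ℕ :=
  Sum.elim (fun r => m + n - 2 * (r : ℕ) - 1) (fun _ => p)

theorem sum_modLen (hmn : m ≤ n) (hnp : n ≤ p) (hp : p + 1 ≤ m + n) :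
    ∑ i, modLen p m n i = m * n := by
  rw [Fintype.sum_sum_type]
  simp only [modLen, Sum.elim_inl, Sum.elim_inr]
  rw [Finset.sum_coe_sort (Finset.Ico (m + n - p) m) (fun r => m + n - 2 * r - 1)]
  obtain ⟨c, hc⟩ : ∃ c, c + p = m + n := ⟨m + n - p, by omega⟩
  rw [show m + n - p = c by omega]
  have hcm : c ≤ m := by omega
  have h1 := sum_chain_length hmn hcm
  have h2 := sum_chain_length hmn le_rfl
  rw [← Finset.sum_range_add_sum_Ico _ hcm] at h2
  simp only [Finset.sum_const, Finset.card_univ, Fintype.card_fin, smul_eq_mul]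
  -- The first c = m+n-p chain lengths add up to c(m+n-c) = cp, so c chains of length p replace them
  -- without changing the total mn.
  have h4 : c * (m + n) = c * c + c * p := by rw [← hc, mul_add]
  have h3 : m * (m + n) = m * m + m * n := mul_add _ _ _
  omega

variable [Fact p.Prime]

/-- If a_r vanished modulo p, Lefschetz injectivity over 𝔽_p would push ρ(α_r) into filtration step
r+1, against its lowest degree r. -/
theorem exists_pow_mul_red_generator (hmn : m ≤ n)
    (hα : IsGeneratorFamily p m n ω α) {r : ℕ} (hr : r < m) (hrp : m + n - p ≤ r) :
    ∃ a : ZMod p, a ≠ 0 ∧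
      xel (ZMod p) m n ^ (m + n - 2 * r - 1 - 1) * red p m n (α r) = a • red p m n (ω r) := by
  obtain ⟨a, -, h⟩ := exists_pow_mul_generator hα hr
  obtain ⟨-, -, -, hlow⟩ := hα r hr
  have h1 := cast_pow_mul_eq (ZMod p) h
  refine ⟨a, fun h0 => (hlow hrp).2 ?_, h1⟩
  obtain ⟨u, hu⟩ : ∃ u, m = u + r + 1 := ⟨m - 1 - r, by omega⟩
  obtain ⟨v, hv⟩ : ∃ v, n = v + r + 1 := ⟨n - 1 - r, by omega⟩
  refine mem_filt_of_xel_pow_mul_mem hu hv (factorial_cast_ne_zero (by omega)) (hlow hrp).1 ?_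
  rw [h0, zero_smul, show m + n - 2 * r - 1 - 1 = u + v by omega] at h1
  rw [h1]
  exact Submodule.zero_mem _

theorem hasLowDegree_last_red (hmn : m ≤ n)
    (hω : IsSocleFamily m n ω) (hα : IsGeneratorFamily p m n ω α) {r : ℕ} (hr : r < m)
    (hrp : m + n - p ≤ r) :
    HasLowDegree (xel (ZMod p) m n ^ (m + n - 2 * r - 1 - 1) * red p m n (α r))
      (m + n - r - 2) := by
  obtain ⟨a, ha, h⟩ := exists_pow_mul_red_generator hmn hα hr hrp
  rw [h]
  exact hasLowDegree_smul ha (hasLowDegree_cast_socle (ZMod p) hω hmn hr)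

/-- The elements `s^k` with `k < m + n - p` generate free summands modulo `p`. -/
theorem hasLowDegree_last_free (hmp : m ≤ p) {k : ℕ} (hk : k < m + n - p)
    (hn : n ≤ p) : HasLowDegree (xel (ZMod p) m n ^ (p - 1) * mono (ZMod p) m n k 0)
      (k + (p - 1)) := by
  have hp1 := (Fact.out : p.Prime).one_lt
  have h0 : mono (ZMod p) m n k 0 = homogenize (ZMod p) m n k (Polynomial.X ^ k) :=
    (homogenize_X_pow k 0).symm
  refine ⟨xel_pow_mul_mem _ (mono_mem_filt (by omega)), fun hmem => ?_⟩
  have e1 := xel_pow_sub_lel_pow_mem (p - 1) (homogenize_mem (R := ZMod p) (m := m) (n := n) k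
    (Polynomial.X ^ k))
  rw [h0] at hmem
  have h1 := Submodule.sub_mem _ hmem e1
  rw [sub_sub_cancel, lel_pow_mul_homogenize (Polynomial.natDegree_X_pow_le k)] at h1
  -- The coefficient of s^(m-1) t^(k+p-m) in (s+t)^(p-1) s^k is the binomial coefficient of p-1 over
  -- m-1-k, which is prime to p.
  have h2 := mem_filt_iff.mp h1 (⟨m - 1, by omega⟩, ⟨k + p - m, by omega⟩) (by simp only; omega)
  have h3 := repr_homogenize (m := m) (n := n)
    ((1 + Polynomial.X) ^ (p - 1) * Polynomial.X ^ k : (ZMod p)[X])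
    (⟨m - 1, by omega⟩, ⟨k + p - m, by omega⟩)
  simp only at h3
  rw [show m - 1 + (k + p - m) = k + (p - 1) by omega, h2,
    show m - 1 = m - 1 - k + k by omega, Polynomial.coeff_mul_X_pow,
    Polynomial.coeff_one_add_X_pow, eq_comm, ZMod.natCast_eq_zero_iff] at h3
  have h4 : (p - 1).choose (m - 1 - k) ∣ (p - 1).factorial :=
    ⟨_, by rw [← Nat.choose_mul_factorial_mul_factorial (show m - 1 - k ≤ p - 1 by omega),
      mul_assoc]⟩
  have := ((Fact.out : p.Prime).dvd_factorial).mp (h3.trans h4)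
  omega

theorem pow_modLen_modGen (hmn : m ≤ n) (hnp : n ≤ p)
    (hω : IsSocleFamily m n ω) (hα : IsGeneratorFamily p m n ω α) (i) :
    (deltaV p m n (hmn.trans hnp) hnp ^ modLen p m n i) (modGen p m n α i) = 0 := by
  rw [deltaV_pow_apply]
  rcases i with r | k
  · exact pow_mul_generator_eq_zero (ZMod p) hmn hω hα (Finset.mem_Ico.mp r.2).2
  · simp only [modLen, Sum.elim_inr, xel_pow_prime p m n (hmn.trans hnp) hnp, zero_mul]

theorem linearIndependent_modGen_last (hmn : m ≤ n) (hnp : n ≤ p)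
    (hω : IsSocleFamily m n ω) (hα : IsGeneratorFamily p m n ω α) :
    LinearIndependent (ZMod p) fun i =>
      (deltaV p m n (hmn.trans hnp) hnp ^ (modLen p m n i - 1)) (modGen p m n α i) := by
  -- The reduced α_r give the degrees n-1, …, p-2 and the s^k give p-1, …, m+n-2, so all are
  -- distinct.
  refine linearIndependent_of_lowDegree _
    (Sum.elim (fun r => m + n - (r : ℕ) - 2) (fun k => (k : ℕ) + (p - 1))) ?_ ?_
  · have hp1 := (Fact.out : p.Prime).one_lt
    rintro (⟨r, hr⟩ | k) (⟨r', hr'⟩ | k') h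
    all_goals simp only [Sum.elim_inl, Sum.elim_inr] at h
    · rw [Finset.mem_Ico] at hr hr'
      congr 2
      omega
    · rw [Finset.mem_Ico] at hr
      omega
    · rw [Finset.mem_Ico] at hr'
      omega
    · congr 1
      exact Fin.ext (by omega)
  · intro i
    rw [deltaV_pow_apply]
    rcases i with ⟨r, hr⟩ | k
    · rw [Finset.mem_Ico] at hr
      exact hasLowDegree_last_red hmn hω hα hr.2 hr.1
    · exact hasLowDegree_last_free (hmn.trans hnp) k.2 hnp

theorem hasLength_red_socle (hmn : m ≤ n) (hnp : n ≤ p) (hp : p + 1 ≤ m + n)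
    (hω : IsSocleFamily m n ω) (hα : IsGeneratorFamily p m n ω α) {r : ℕ} (hr : r < m)
    (hrp : m + n - p ≤ r) :
    HasLength (deltaV p m n (hmn.trans hnp) hnp) (red p m n (ω r)) (m + n - 2 * r - 1) := by
  have := finiteDimensional_TT (ZMod p) m n
  obtain ⟨a, ha, h⟩ := exists_pow_mul_red_generator hmn hα hr hrp
  rw [← deltaV_pow_apply p m n (hmn.trans hnp) hnp] at h
  refine ⟨⟨by omega, a⁻¹ • red p m n (α r), ?_⟩, fun k hk => ?_⟩
  · rw [map_smul, h, inv_smul_smul₀ ha]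
  · by_contra! hlt
    obtain ⟨-, y, hy⟩ := hk
    -- A greater length would put the last vector of chain r, a multiple of ρ(ω_r), into the image
    -- of Δ^(m+n-2r-1).
    refine jordan_notMem_range _ (modGen p m n α) (modLen p m n)
      (pow_modLen_modGen hmn hnp hω hα) (linearIndependent_modGen_last hmn hnp hω hα)
      ((sum_modLen hmn hnp hp).trans (finrank_TT _ _ _).symm)
      (Sum.inl ⟨r, Finset.mem_Ico.mpr ⟨hrp, hr⟩⟩) ?_ ?_
    · simp only [modLen, Sum.elim_inl]
      omega
    · simp only [modLen, modGen, Sum.elim_inl]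
      rw [h]
      refine Submodule.smul_mem _ _
        ⟨(deltaV p m n (hmn.trans hnp) hnp ^ (k - 1 - (m + n - 2 * r - 1))) y, ?_⟩
      rw [← Module.End.mul_apply, ← pow_add, ← hy]
      congr 2
      omega

theorem mem_cyclicSpan_of_incl_mem (hmn : m ≤ n) (hnp : n ≤ p)
    (hω : IsSocleFamily m n ω) (hα : IsGeneratorFamily p m n ω α) {r : ℕ} (hr : r < m)
    (hrp : m + n - p ≤ r) {l : ℕ} (hl : l = m + n - 2 * r - 1) {h : TT ℤ m n}
    (hh : incl m n h ∈ cyclicSpan (deltaM ℚ m n) (incl m n (α r)) l) :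
    red p m n h ∈ cyclicSpan (deltaV p m n (hmn.trans hnp) hnp) (red p m n (α r)) l := by
  -- Clear denominators in the rational combination, with |k| minimal. If p divided k, independence
  -- of the chain modulo p would make p divide every z_j, and p could be cancelled. So k is
  -- invertible modulo p.
  have hex : ∃ N, ∃ k : ℤ, k ≠ 0 ∧ k.natAbs = N ∧ ∃ z : Fin l → ℤ,
      k • h = ∑ j, z j • (xel ℤ m n ^ (j : ℕ) * α r) := by
    rw [cyclicSpan_eq, Submodule.mem_span_range_iff_exists_fun] at hh
    obtain ⟨c, hc⟩ := hh
    obtain ⟨b, hb⟩ := IsLocalization.exist_integer_multiples_of_finite (nonZeroDivisors ℤ) c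
    choose z hz using hb
    refine ⟨_, (b : ℤ), nonZeroDivisors.coe_ne_zero b, rfl, z, castTT_injective (S := ℚ) ?_⟩
    rw [castTT_smul, ← incl, ← hc, Finset.smul_sum, map_sum]
    refine Finset.sum_congr rfl fun j _ => ?_
    have h1 : (z j : ℚ) = ((b : ℤ) : ℚ) * c j := by
      have := hz j
      rwa [zsmul_eq_mul] at this
    rw [castTT_smul, h1, mul_smul, deltaM_pow_apply, map_mul, map_pow, castTT_xel]
  classical
  obtain ⟨k, hk, hkN, z, hz⟩ := Nat.find_spec hex
  have hzp : (k : ZMod p) • red p m n h =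
      ∑ j, (z j : ZMod p) • (deltaV p m n (hmn.trans hnp) hnp ^ (j : ℕ)) (red p m n (α r)) := by
    rw [← castTT_smul, hz, map_sum]
    refine Finset.sum_congr rfl fun j _ => ?_
    rw [castTT_smul, deltaV_pow_apply, map_mul, map_pow, castTT_xel]
  have hkp : (k : ZMod p) ≠ 0 := by
    intro hk0
    rw [hk0, zero_smul] at hzp
    have hli := linearIndependent_chain (deltaV p m n (hmn.trans hnp) hnp) (red p m n (α r)) l
      (by rw [deltaV_pow_apply, hl]; exact pow_mul_generator_eq_zero (ZMod p) hmn hω hα hr)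
      (by
        rw [deltaV_pow_apply, hl]
        exact ne_zero_of_hasLowDegree (hasLowDegree_last_red hmn hω hα hr hrp))
    have hz0 := fun j => (ZMod.intCast_zmod_eq_zero_iff_dvd _ p).mp
      (Fintype.linearIndependent_iff.mp hli _ hzp.symm j)
    choose z' hz' using hz0
    obtain ⟨k', rfl⟩ := (ZMod.intCast_zmod_eq_zero_iff_dvd _ p).mp hk0
    have hk' : k' ≠ 0 := right_ne_zero_of_mul hk
    have hp0 : (p : ℤ) ≠ 0 := left_ne_zero_of_mul hk
    refine Nat.find_min hex (m := k'.natAbs) ?_ ⟨k', hk', rfl, z', ?_⟩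
    · rw [← hkN, Int.natAbs_mul, Int.natAbs_natCast]
      exact lt_mul_of_one_lt_left (Int.natAbs_pos.mpr hk') (Fact.out : p.Prime).one_lt
    · refine sub_eq_zero.mp (smul_eq_zero_of_ne_zero hp0 ?_)
      rw [smul_sub, ← mul_smul, hz, Finset.smul_sum, sub_eq_zero]
      refine Finset.sum_congr rfl fun j _ => ?_
      rw [hz', mul_smul]
  rw [← Submodule.smul_mem_iff _ hkp, hzp]
  exact Submodule.sum_mem _ fun j _ => Submodule.smul_mem _ _ (Submodule.subset_span ⟨j, j.2, rfl⟩)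

/-- Coefficients in 𝔽_p lift to ℤ, so the combination itself lifts to one of the integral chain. -/
theorem exists_incl_mem_of_mem_cyclicSpan {hmp : m ≤ p} {hnp : n ≤ p} {v : TT ℤ m n} {l : ℕ}
    {y : TT (ZMod p) m n} (hy : y ∈ cyclicSpan (deltaV p m n hmp hnp) (red p m n v) l) :
    ∃ h : TT ℤ m n, incl m n h ∈ cyclicSpan (deltaM ℚ m n) (incl m n v) l ∧
      red p m n h = y := by
  induction hy using Submodule.span_induction with
  | mem x hx =>
    obtain ⟨j, hj, rfl⟩ := hx
    refine ⟨xel ℤ m n ^ j * v, Submodule.subset_span ⟨j, hj, ?_⟩, ?_⟩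
    · rw [deltaM_pow_apply, map_mul, map_pow, castTT_xel]
    · rw [deltaV_pow_apply, map_mul, map_pow, castTT_xel]
  | zero => exact ⟨0, by rw [map_zero]; exact Submodule.zero_mem _, map_zero _⟩
  | add x y _ _ hx hy =>
    obtain ⟨a, ha, rfl⟩ := hx
    obtain ⟨b, hb, rfl⟩ := hy
    exact ⟨a + b, by rw [map_add]; exact Submodule.add_mem _ ha hb, map_add _ _ _⟩
  | smul c x _ hx =>
    obtain ⟨a, ha, rfl⟩ := hx
    obtain ⟨c, rfl⟩ := ZMod.intCast_surjective c
    exact ⟨c • a, by rw [castTT_smul]; exact Submodule.smul_mem _ _ ha, castTT_smul c a⟩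

end Decomposition

end CyclicTensor

end

/-! ### Assembly of the theorem -/

theorem mainTheorem8 (p : ℕ) [Fact p.Prime] (m n : ℕ) (hm : 1 ≤ m) (hmn : m ≤ n) (hnp : n ≤ p)
    (hp : p + 1 ≤ m + n) :
    (∃ ω : ℕ → TT ℤ m n, IsSocleFamily m n ω) ∧
    ∀ ω : ℕ → TT ℤ m n, IsSocleFamily m n ω →
      (∀ r : ℕ, m + n - p ≤ r → r ≤ m - 1 →
        HasLength (deltaV p m n (hmn.trans hnp) hnp) (red p m n (ω r)) (m + n - 2 * r - 1)) ∧
      (∃ α : ℕ → TT ℤ m n, IsGeneratorFamily p m n ω α) ∧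
      ∀ α : ℕ → TT ℤ m n, IsGeneratorFamily p m n ω α →
        ∃ (M : Fin m → Subrepresentation (repMM ℚ m n))
          (V : Finset.Ico (m + n - p) m →
            Subrepresentation (repVV p m n (hmn.trans hnp) hnp))
          (P : Fin (m + n - p) → Subrepresentation (repVV p m n (hmn.trans hnp) hnp)),
          (∀ r : Fin m,
            (M r).toSubmodule =
              cyclicSpan (deltaM ℚ m n) (incl m n (α r)) (m + n - 2 * (r : ℕ) - 1) ∧
            IsIsoM (M r).toRepresentation (m + n - 2 * (r : ℕ) - 1) ∧
            IsIndecomposable (M r).toRepresentation) ∧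
          DirectSum.IsInternal (fun r : Fin m => (M r).toSubmodule) ∧
          (∀ r : Finset.Ico (m + n - p) m,
            (V r).toSubmodule =
              cyclicSpan (deltaV p m n (hmn.trans hnp) hnp) (red p m n (α r))
                (m + n - 2 * (r : ℕ) - 1) ∧
            IsIsoV p (V r).toRepresentation (m + n - 2 * (r : ℕ) - 1) ∧
            IsIndecomposable (V r).toRepresentation) ∧
          (∀ k : Fin (m + n - p), IsIsoV p (P k).toRepresentation p) ∧
          DirectSum.IsInternal
            (Sum.elim (fun r => (V r).toSubmodule) (fun k => (P k).toSubmodule)) ∧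
          (∀ (r : Fin m) (hr : (r : ℕ) ∈ Finset.Ico (m + n - p) m),
            red p m n '' (incl m n ⁻¹' ((M r).toSubmodule : Set (TT ℚ m n))) =
              ((V ⟨r, hr⟩).toSubmodule : Set (TT (ZMod p) m n))) := by
  have : FiniteDimensional ℚ (TT ℚ m n) := finiteDimensional_TT ℚ m n
  have : FiniteDimensional (ZMod p) (TT (ZMod p) m n) := finiteDimensional_TT (ZMod p) m n
  refine ⟨exists_isSocleFamily hmn, fun ω hω => ?_⟩
  -- The length statement does not mention α but is proved through a decomposition, so one generator
  -- family is fixed for it.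
  obtain ⟨α₀, hα₀⟩ := exists_isGeneratorFamily p hmn hω
  refine ⟨fun r hrp hr => hasLength_red_socle hmn hnp hp hω hα₀ (by omega) hrp, ⟨α₀, hα₀⟩,
    fun α hα => ?_⟩
  have hM0 : ∀ r : Fin m, (deltaM ℚ m n ^ (m + n - 2 * (r : ℕ) - 1)) (incl m n (α r)) = 0 :=
    fun r => by
      rw [deltaM_pow_apply]
      exact pow_mul_generator_eq_zero ℚ hmn hω hα r.2
  have hM1 : ∀ r : Fin m, HasLowDegree
      ((deltaM ℚ m n ^ (m + n - 2 * (r : ℕ) - 1 - 1)) (incl m n (α r))) (m + n - r - 2) :=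
    fun r => by
      rw [deltaM_pow_apply]
      exact hasLowDegree_last_rat hmn hω hα r.2
  have hV0 := pow_modLen_modGen hmn hnp hω hα
  have hVli := linearIndependent_modGen_last hmn hnp hω hα
  have hlen : ∀ r : Finset.Ico (m + n - p) m, m + n - 2 * (r : ℕ) - 1 ≤ p := fun r => by
    have := Finset.mem_Ico.mp r.2
    omega
  refine ⟨fun r => cyclicSubrep (repMM ℚ m n) mem_zpowers_int _ _ (hM0 r),
    fun r => cyclicSubrep (repVV p m n (hmn.trans hnp) hnp) (mem_zpowers_zmod p) _ _
      (hV0 (Sum.inl r)),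
    fun k => cyclicSubrep (repVV p m n (hmn.trans hnp) hnp) (mem_zpowers_zmod p) _ _
      (hV0 (Sum.inr k)), fun r => ⟨rfl, ?_, ?_⟩, ?_, fun r => ⟨rfl, ⟨hlen r, ?_⟩, ?_⟩,
      fun k => ⟨le_rfl, ?_⟩, ?_, fun r hr => ?_⟩
  · exact cyclicSubrep_equiv _ _ _ _ _ (ne_zero_of_hasLowDegree (hM1 r)) _
      (repM_apply_generator ℚ _)
  · exact cyclicSubrep_isIndecomposable _ _ _ _ _ (ne_zero_of_hasLowDegree (hM1 r))
  · refine isInternal_jordan (deltaM ℚ m n) (fun r : Fin m => incl m n (α r))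
      (fun r => m + n - 2 * (r : ℕ) - 1) hM0
      (linearIndependent_of_lowDegree _ (fun r : Fin m => m + n - (r : ℕ) - 2) ?_ hM1) ?_
    · intro r r' h
      simp only at h
      exact Fin.ext (by omega)
    · rw [finrank_TT, Fin.sum_univ_eq_sum_range (fun r => m + n - 2 * r - 1) m]
      have h1 := sum_chain_length hmn le_rfl
      rw [mul_add] at h1
      omega
  · exact cyclicSubrep_equiv _ _ _ _ _ (hVli.ne_zero (Sum.inl r)) _
      (repV_apply_generator p _ (hlen r))
  · exact cyclicSubrep_isIndecomposable _ _ _ _ _ (hVli.ne_zero (Sum.inl r))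
  · exact cyclicSubrep_equiv _ _ _ _ _ (hVli.ne_zero (Sum.inr k)) _
      (repV_apply_generator p _ le_rfl)
  · have h1 := isInternal_jordan _ _ _ hV0 hVli
      ((sum_modLen hmn hnp hp).trans (finrank_TT _ _ _).symm)
    refine (congrArg (fun A : _ → Submodule (ZMod p) (TT (ZMod p) m n) =>
      DirectSum.IsInternal A) (funext fun i => ?_)).mpr h1
    rcases i with r | k <;> rfl
  · obtain ⟨hr1, hr2⟩ := Finset.mem_Ico.mp hr
    ext y
    constructor
    · rintro ⟨h, hh, rfl⟩
      exact mem_cyclicSpan_of_incl_mem hmn hnp hω hα hr2 hr1 rfl hh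
    · intro hy
      obtain ⟨h, hh, rfl⟩ := exists_incl_mem_of_mem_cyclicSpan hy
      exact ⟨h, hh, rfl⟩
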